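/- Let $\ell>1$ be an odd integer, let $q\in\mathbb{C}$ be a primitive $\ell$-th root of unity, and let $N\ge 0$ be an integer. Let $\mathcal{D}_q(\mathbb{C}^N)$ be the associative unital $\mathbb{C}$-algebra generated by $x_1,\dots,x_N,\partial_1,\dots,\partial_N$ with relations $$x_jx_i=q\,x_ix_j,\quad \partial_j\partial_i=q^{-1}\partial_i\partial_j\quad (j>i),\qquad \partial_jx_i=q\,x_i\partial_j\quad (j\ne i),$$ $$\partial_ix_i=q^2x_i\partial_i+(q^2-1)\Bigl(1+\sum_{j=1}^{i-1}x_j\partial_j\Bigr).$$ Let $Z_N$ be its centre and put $\beta_i=1+\sum_{j=1}^{i}x_j\partial_j$ for $i=0,\dots,N$; the elements $\beta_i^\ell$ lie in $Z_N$. Let $Z_N^\circ$ be the localization of $Z_N$ at the multiplicative set generated by $\beta_0^\ell,\dots,\beta_N^\ell$, and let $\mathcal{D}_q(\mathbb{C}^N)^\circ=\mathcal{D}_q(\mathbb{C}^N)\otimes_{Z_N}Z_N^\circ$. For a $\mathbb{C}$-algebra $A$ that is finitely generated and projective as a module over its centre $Z$, the Azumaya locus of $A$ is the set of maximal ideals $\mathfrak{m}$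 of $Z$ for which there are an $n>0$ and an isomorphism of $\mathbb{C}$-algebras $A\otimes_Z Z/\mathfrak{m}\simeq \mathrm{Mat}_{n\times n}(\mathbb{C})$; and $A$ is called Azumaya over $Z$ if its Azumaya locus is the whole maximal spectrum of $Z$. Then $\mathcal{D}_q(\mathbb{C}^N)$ is finitely generated and projective over $Z_N$, and its Azumaya locus is $\mathrm{Spec}(Z_N^\circ)$, that is, the set of those closed points of $\mathrm{Spec}(Z_N)$ that lie in the image of $\mathrm{Spec}(Z_N^\circ)\to\mathrm{Spec}(Z_N)$; equivalently, the set of maximal ideals of $Z_N$ that contain none of the $\beta_i^\ell$. Moreover, $Z_N^\circ$ is the centre of $\mathcal{D}_q(\mathbb{C}^N)^\circ$, and $\mathcal{D}_q(\mathbb{C}^N)^\circ$ is Azumaya over $Z_N^\circ$ (both in the above sense and in the sense that it is a finitely generated projective faithful $Z_N^\circ$-module $A$ with $A\otimes_{Z_N^\circ} A^{\mathrm{op}}\to\mathrm{End}_{Z_N^\circ}(A)$, $a\otimes b\mapsto(y\mapsto ayb)$, bijective), of rank $\ell^N\times\ell^N$: its fibre at every maximal ideal of $Z_N^\circ$ is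 isomorphic to $\mathrm{Mat}_{\ell^N\times\ell^N}(\mathbb{C})$ as a $\mathbb{C}$-algebra. -/

import Mathlib

open scoped TensorProduct

noncomputable section

/-! ## Azumaya loci of algebras over `ℂ` -/

namespace AzumayaLocus

variable (Z A : Type) [CommRing Z] [Ring A] [Algebra ℂ Z] [Algebra Z A]

/-- The fibre of the `Z`-algebra `A` at the closed point `m` of `Spec Z` is isomorphic, as a
`ℂ`-algebra, to the algebra of `n × n` complex matrices. -/
def FiberIsMatrix (m : MaximalSpectrum Z) (n : ℕ) : Prop :=
  Nonempty (((Z ⧸ m.asIdeal) ⊗[Z] A) ≃ₐ[ℂ] Matrix (Fin n) (Fin n) ℂ)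

/-- The Azumaya locus: the set of closed points of `Spec Z` at which the fibre of `A` is a matrix
algebra over `ℂ` (of some positive size). It is used for algebras `A` that are finitely generated
and projective over their centre `Z`. -/
def azumayaLocus : Set (MaximalSpectrum Z) :=
  {m | ∃ n : ℕ, 0 < n ∧ FiberIsMatrix Z A m n}

/-- `A` is Azumaya over `Z`: `Z` is (identified by the structure map with) the centre of `A`,
`A` is finitely generated and projective over `Z`, and the Azumaya locus is everything. -/
structure IsAzumayaOver : Prop where
  injective : Function.Injective (algebraMap Z A)
  range_eq_center : Set.range (algebraMap Z A) = Set.center A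
  finite : Module.Finite Z A
  projective : Module.Projective Z A
  locus_eq_univ : azumayaLocus Z A = Set.univ

end AzumayaLocus

/-! ## The algebra of `q`-difference operators -/

namespace QDiff

/-- Free generator `x_i` (`i = 0, …, N - 1`). -/
abbrev freeX (N : ℕ) (i : Fin N) : FreeAlgebra ℂ (Fin N ⊕ Fin N) := FreeAlgebra.ι ℂ (Sum.inl i)

/-- Free generator `∂_i` (`i = 0, …, N - 1`). -/
abbrev freeD (N : ℕ) (i : Fin N) : FreeAlgebra ℂ (Fin N ⊕ Fin N) := FreeAlgebra.ι ℂ (Sum.inr i)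

/-- The defining relations. -/
inductive Rel (q : ℂ) (N : ℕ) :
    FreeAlgebra ℂ (Fin N ⊕ Fin N) → FreeAlgebra ℂ (Fin N ⊕ Fin N) → Prop
  | xx (i j : Fin N) (h : i < j) :
      Rel q N (freeX N j * freeX N i) (q • (freeX N i * freeX N j))
  | dd (i j : Fin N) (h : i < j) :
      Rel q N (freeD N j * freeD N i) (q⁻¹ • (freeD N i * freeD N j))
  | dx (i j : Fin N) (h : j ≠ i) :
      Rel q N (freeD N j * freeX N i) (q • (freeX N i * freeD N j))
  | dx_self (i : Fin N) :
      Rel q N (freeD N i * freeX N i)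
        (q ^ 2 • (freeX N i * freeD N i) +
          (q ^ 2 - 1) • (1 + ∑ j ∈ Finset.Iio i, freeX N j * freeD N j))

/-- The algebra `D_q(ℂ^N)`. -/
def Dq (q : ℂ) (N : ℕ) : Type := RingQuot (Rel q N)

instance (q : ℂ) (N : ℕ) : Ring (Dq q N) := inferInstanceAs (Ring (RingQuot (Rel q N)))

instance (q : ℂ) (N : ℕ) : Algebra ℂ (Dq q N) :=
  inferInstanceAs (Algebra ℂ (RingQuot (Rel q N)))

/-- The quotient map from the free algebra. -/
def mk (q : ℂ) (N : ℕ) : FreeAlgebra ℂ (Fin N ⊕ Fin N) →ₐ[ℂ] Dq q N :=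
  RingQuot.mkAlgHom ℂ (Rel q N)

theorem mk_surjective (q : ℂ) (N : ℕ) : Function.Surjective (mk q N) :=
  RingQuot.mkAlgHom_surjective ℂ (Rel q N)

theorem mk_rel {q : ℂ} {N : ℕ} {a b : FreeAlgebra ℂ (Fin N ⊕ Fin N)} (h : Rel q N a b) :
    mk q N a = mk q N b :=
  RingQuot.mkAlgHom_rel ℂ h

variable (q : ℂ) (N : ℕ)

/-- The generator `x_i` of `D_q(ℂ^N)`. -/
def x (i : Fin N) : Dq q N := mk q N (freeX N i)

/-- The generator `∂_i` of `D_q(ℂ^N)`. -/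
def d (i : Fin N) : Dq q N := mk q N (freeD N i)

/-- `β_k = 1 + ∑ x_j ∂_j`, the sum over the first `k` indices; used for `k = 0, …, N`. -/
def beta (k : ℕ) : Dq q N := 1 + ∑ j : Fin N with j.val < k, x q N j * d q N j

/-! ### Centrality of `β_k ^ ℓ` -/

theorem x_mul_x (i j : Fin N) (h : i < j) :
    x q N j * x q N i = q • (x q N i * x q N j) := by
  simpa [x] using mk_rel (Rel.xx (q := q) i j h)

theorem d_mul_d (i j : Fin N) (h : i < j) :
    d q N j * d q N i = q⁻¹ • (d q N i * d q N j) := by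
  simpa [d] using mk_rel (Rel.dd (q := q) i j h)

theorem d_mul_x (i j : Fin N) (h : j ≠ i) :
    d q N j * x q N i = q • (x q N i * d q N j) := by
  simpa [x, d] using mk_rel (Rel.dx (q := q) i j h)

theorem d_mul_x_self (i : Fin N) :
    d q N i * x q N i =
      q ^ 2 • (x q N i * d q N i) + (q ^ 2 - 1) • beta q N i.val := by
  have h := mk_rel (Rel.dx_self (q := q) i)
  have e : (Finset.univ.filter fun j : Fin N => j.val < i.val) = Finset.Iio i := by
    ext j; simp
  rw [beta, e]
  simpa [x, d] using h

theorem beta_succ (i : Fin N) :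
    beta q N (i.val + 1) = beta q N i.val + x q N i * d q N i := by
  have e : (Finset.univ.filter fun j : Fin N => j.val < i.val + 1) =
      insert i (Finset.univ.filter fun j : Fin N => j.val < i.val) := by
    ext j; simp [Fin.ext_iff]; omega
  rw [beta, e, Finset.sum_insert (by simp), beta]
  abel

theorem beta_succ_of_le (k : ℕ) (h : N ≤ k) : beta q N (k + 1) = beta q N k := by
  have e : (Finset.univ.filter fun j : Fin N => j.val < k + 1) =
      (Finset.univ.filter fun j : Fin N => j.val < k) := by
    ext j; simp; omega
  rw [beta, e, beta]

theorem beta_mul_x (k : ℕ) (j : Fin N) :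
    beta q N k * x q N j =
      (if j.val < k then q ^ 2 else 1) • (x q N j * beta q N k) := by
  induction k with
  | zero => simp [beta]
  | succ k ih =>
    by_cases hk : k < N
    · obtain ⟨i, rfl⟩ : ∃ i : Fin N, i.val = k := ⟨⟨k, hk⟩, rfl⟩
      rw [beta_succ, add_mul, mul_add, ih, smul_add]
      rcases lt_trichotomy j i with h | h | h
      · have h1 : j.val < i.val := h
        rw [if_pos h1, if_pos (by omega), mul_assoc, d_mul_x q N j i h.ne', mul_smul_comm,
          ← mul_assoc, x_mul_x q N j i h, smul_mul_assoc, smul_smul, mul_assoc, pow_two]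
      · subst h
        rw [if_neg (by omega), if_pos (by omega), mul_assoc, d_mul_x_self, mul_add,
          mul_smul_comm, mul_smul_comm]
        module
      · have h1 : i.val < j.val := h
        rw [if_neg (by omega), if_neg (by omega), mul_assoc, d_mul_x q N j i h.ne,
          mul_smul_comm, ← mul_assoc, ← mul_assoc, x_mul_x q N i j h, smul_mul_assoc, one_smul,
          one_smul]
    · rw [beta_succ_of_le q N k (by omega), ih, if_pos (by omega), if_pos (by omega)]

theorem d_mul_beta (hq : q ≠ 0) (k : ℕ) (j : Fin N) :
    d q N j * beta q N k =
      (if j.val < k then q ^ 2 else 1) • (beta q N k * d q N j) := by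
  induction k with
  | zero => simp [beta]
  | succ k ih =>
    by_cases hk : k < N
    · obtain ⟨i, rfl⟩ : ∃ i : Fin N, i.val = k := ⟨⟨k, hk⟩, rfl⟩
      rw [beta_succ, add_mul, mul_add, ih, smul_add]
      rcases lt_trichotomy j i with h | h | h
      · have h1 : j.val < i.val := h
        have h2 : d q N j * d q N i = q • (d q N i * d q N j) := by
          rw [d_mul_d q N j i h, smul_smul, mul_inv_cancel₀ hq, one_smul]
        rw [if_pos h1, if_pos (by omega), ← mul_assoc, d_mul_x q N i j h.ne, smul_mul_assoc,
          mul_assoc, h2, mul_smul_comm, smul_smul, mul_assoc, pow_two]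
      · subst h
        rw [if_neg (by omega), if_pos (by omega), ← mul_assoc, d_mul_x_self, add_mul,
          smul_mul_assoc, smul_mul_assoc]
        module
      · have h1 : i.val < j.val := h
        rw [if_neg (by omega), if_neg (by omega), ← mul_assoc, d_mul_x q N i j h.ne',
          smul_mul_assoc, mul_assoc, d_mul_d q N i j h, mul_smul_comm, smul_smul,
          mul_inv_cancel₀ hq, one_smul, one_smul, one_smul, mul_assoc]
    · rw [beta_succ_of_le q N k (by omega), ih, if_pos (by omega), if_pos (by omega)]

theorem pow_mul_of_qcomm {A : Type} [Ring A] [Algebra ℂ A] (c : ℂ) (a b : A)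
    (h : a * b = c • (b * a)) (n : ℕ) : a ^ n * b = c ^ n • (b * a ^ n) := by
  induction n with
  | zero => simp
  | succ n ih =>
    rw [pow_succ, mul_assoc, h, mul_smul_comm, ← mul_assoc, ih, smul_mul_assoc, smul_smul,
      mul_assoc, pow_succ, mul_comm]

theorem mul_pow_of_qcomm {A : Type} [Ring A] [Algebra ℂ A] (c : ℂ) (a b : A)
    (h : b * a = c • (a * b)) (n : ℕ) : b * a ^ n = c ^ n • (a ^ n * b) := by
  induction n with
  | zero => simp
  | succ n ih =>
    rw [pow_succ, ← mul_assoc, ih, smul_mul_assoc, mul_assoc, h, mul_smul_comm, smul_smul,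
      ← mul_assoc, pow_succ]

theorem mem_center_of_comm (z : Dq q N) (hx : ∀ i, x q N i * z = z * x q N i)
    (hd : ∀ i, d q N i * z = z * d q N i) : z ∈ Subalgebra.center ℂ (Dq q N) := by
  rw [Subalgebra.mem_center_iff]
  intro b
  obtain ⟨b, rfl⟩ := mk_surjective q N b
  induction b using FreeAlgebra.induction with
  | grade0 r => rw [AlgHom.commutes]; exact Algebra.commutes r z
  | grade1 s =>
    rcases s with i | i
    · exact hx i
    · exact hd i
  | mul a b ha hb => rw [map_mul, mul_assoc, hb, ← mul_assoc, ha, mul_assoc]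
  | add a b ha hb => rw [map_add, add_mul, mul_add, ha, hb]

variable {q} {ℓ : ℕ}

theorem beta_pow_mem_center (hq : IsPrimitiveRoot q ℓ) (k : ℕ) :
    beta q N k ^ ℓ ∈ Subalgebra.center ℂ (Dq q N) := by
  rcases Nat.eq_zero_or_pos ℓ with rfl | hℓ
  · rw [pow_zero]; exact one_mem _
  have hc : ∀ j : Fin N, (if j.val < k then q ^ 2 else 1) ^ ℓ = 1 := by
    intro j
    split_ifs
    · rw [← pow_mul, mul_comm, pow_mul, hq.pow_eq_one, one_pow]
    · exact one_pow _
  refine mem_center_of_comm q N _ (fun i => ?_) (fun i => ?_)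
  · rw [pow_mul_of_qcomm _ _ _ (beta_mul_x q N k i), hc, one_smul]
  · rw [mul_pow_of_qcomm _ _ _ (d_mul_beta q N (hq.ne_zero hℓ.ne') k i), hc, one_smul]

/-! ### The localization -/

variable (q)

/-- The centre `Z_N` of `D_q(ℂ^N)`. -/
abbrev Zc : Type := Subalgebra.center ℂ (Dq q N)

/-- `D_q(ℂ^N)` as an algebra over its centre, through the inclusion. -/
instance : Algebra (Zc q N) (Dq q N) where
  algebraMap := (Subalgebra.center ℂ (Dq q N)).val.toRingHom
  commutes' z a := (Subalgebra.mem_center_iff.mp z.2 a).symm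
  smul_def' _ _ := rfl

variable {q}

/-- `β_k ^ ℓ` as an element of the centre. -/
def betaPow (hq : IsPrimitiveRoot q ℓ) (k : ℕ) : Zc q N :=
  ⟨beta q N k ^ ℓ, beta_pow_mem_center N hq k⟩

/-- The multiplicative set generated by the `β_k ^ ℓ`, `k = 0, …, N`. -/
def betaSubmonoid (hq : IsPrimitiveRoot q ℓ) : Submonoid (Zc q N) :=
  Submonoid.closure (Set.range fun k : Fin (N + 1) => betaPow N hq k.val)

/-- `Z_N°`, the localization of `Z_N` at the `β_k ^ ℓ`. -/
abbrev ZLoc (hq : IsPrimitiveRoot q ℓ) : Type := Localization (betaSubmonoid N hq)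

/-- `D_q(ℂ^N)°`, the base change of `D_q(ℂ^N)` from `Z_N` to `Z_N°`. -/
abbrev DLoc (hq : IsPrimitiveRoot q ℓ) : Type := ZLoc N hq ⊗[Zc q N] Dq q N

end QDiff

end

/-! The engine is a lower bound on dimensions of modules. The elements `β_k` commute, so over an
algebraically closed field a finite-dimensional nonzero module has a joint eigenvector. If the `β_k
^ ℓ` act by nonzero scalars, then `x_i`, or a power of `∂_i` when `x_i` kills the vector, moves it
to a joint eigenvector whose `β_k`-eigenvalues for `k > i` (counting `i` from 0) are multiplied by
`q ^ 2`. Since `ℓ` is odd, `q ^ 2` has order `ℓ`, so at least `ℓ ^ N` distinct weights occur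
(`pow_le_finrank`). By Schur and Jacobson density, a nonzero algebra of dimension at most `ℓ ^ (2N)`
that receives `D_q` in this way must be the algebra of `ℓ ^ N × ℓ ^ N` matrices
(`nonempty_algEquiv_matrix`).

This criterion is used twice. First, generically: the `x_i ^ ℓ` and `∂_i ^ ℓ` are central, and the
monomials with exponents below `ℓ` span `D_q` over the polynomials in them. An explicit
representation by weighted shifts on functions on `(ℤ/ℓ)^N` makes these central elements act as
algebraically independent scalars in a large field `K`. The criterion shows that the image generates
the whole endomorphism algebra, so the `ℓ ^ (2N)` spanning monomials map to a `K`-basis. Hence the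
representation is faithful, the centre acts by scalars, and the monomials form a basis of `D_q` over
its centre, which is generated by the `x_i ^ ℓ` and `∂_i ^ ℓ`.

Second, fibrewise: where no `β_k ^ ℓ` vanishes, the fibre has dimension `ℓ ^ (2N)` and is a matrix
algebra. Where some `β_k ^ ℓ` vanishes, `β_k` is a nilpotent normal element of the fibre; in a
matrix algebra it would have to be zero, but its coordinate at the basis element 1 is 1
(`betaPow_not_mem_of_fiberIsMatrix`).

The localized algebra is free with all fibres matrix algebras, and Nakayama upgrades this to
bijectivity of `A ⊗ Aᵒᵖ → End A`, which also identifies the centre. -/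

noncomputable section


/-! ## Ordered monomials in skew-commuting elements -/

section OrderedMonomial

variable {A : Type}

/-- The ordered monomial `y 0 ^ a 0 * y 1 ^ a 1 * ⋯`. -/
def orderedMonomial [Monoid A] {n : ℕ} (y : Fin n → A) (a : Fin n → ℕ) : A :=
  (List.ofFn fun i => y i ^ a i).prod

theorem orderedMonomial_zero [Monoid A] {n : ℕ} (y : Fin n → A) : orderedMonomial y 0 = 1 := by
  refine List.prod_eq_one fun b hb => ?_
  obtain ⟨i, rfl⟩ := (List.mem_ofFn' _ _).1 hb
  simp

theorem orderedMonomial_succ [Monoid A] {n : ℕ} (y : Fin (n + 1) → A) (a : Fin (n + 1) → ℕ) :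
    orderedMonomial y a =
      y 0 ^ a 0 * orderedMonomial (fun i => y i.succ) (fun i => a i.succ) := by
  rw [orderedMonomial, List.ofFn_succ, List.prod_cons, orderedMonomial]

theorem exists_mul_orderedMonomial [Ring A] [Algebra ℂ A] {n : ℕ} (y : Fin n → A)
    (h : ∀ i j, ∃ c : ℂ, y j * y i = c • (y i * y j)) (i : Fin n) (a : Fin n → ℕ) :
    ∃ c : ℂ, y i * orderedMonomial y a = c • orderedMonomial y (a + Pi.single i 1) := by
  induction n with
  | zero => exact i.elim0
  | succ n ih =>
    simp only [orderedMonomial_succ]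
    refine Fin.cases ?_ (fun j => ?_) i
    · refine ⟨1, ?_⟩
      rw [← mul_assoc, ← pow_succ', one_smul]
      simp
    · obtain ⟨c, hc⟩ := h 0 j.succ
      obtain ⟨c', hc'⟩ := ih (fun i => y i.succ) (fun i j => h i.succ j.succ) j
        (fun i => a i.succ)
      refine ⟨c ^ a 0 * c', ?_⟩
      rw [← mul_assoc, QDiff.mul_pow_of_qcomm c _ _ hc, smul_mul_assoc, mul_assoc, hc',
        mul_smul_comm, smul_smul]
      have e : (fun k : Fin n => (a + Pi.single j.succ 1 : Fin (n + 1) → ℕ) k.succ) =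
          (fun k => a k.succ) + Pi.single j 1 := by
        funext k
        by_cases hk : k = j
        · subst hk; simp
        · simp [hk]
      rw [e]
      simp

/-- No commutation among the `y i` is needed: each `y i ^ m` is a scalar and is pulled out where it
stands. -/
theorem orderedMonomial_mul_add {C : Type*} [CommRing C] [Ring A] [Algebra C A] {n : ℕ}
    (y : Fin n → A) (m : ℕ) (z : Fin n → C) (hz : ∀ i, y i ^ m = algebraMap C A (z i))
    (a b : Fin n → ℕ) :
    orderedMonomial y (fun i => m * b i + a i) = (∏ i, z i ^ b i) • orderedMonomial y a := by
  induction n with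
  | zero => simp [orderedMonomial]
  | succ n ih =>
    rw [orderedMonomial_succ, orderedMonomial_succ,
      ih (fun i => y i.succ) (fun i => z i.succ) (fun i => hz i.succ), Fin.prod_univ_succ,
      pow_add, pow_mul, hz, ← map_pow, ← Algebra.smul_def, smul_mul_smul_comm]

end OrderedMonomial

namespace QDiff

variable {q : ℂ} {N ℓ : ℕ}

/-! ## The central elements `x_i ^ ℓ` and `∂_i ^ ℓ` -/

/-- The correction coefficient vanishes at exponent `ℓ`, which is why `x_i ^ ℓ` commutes with `∂_i`.
-/
theorem d_mul_x_pow_succ (i : Fin N) (n : ℕ) :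
    d q N i * x q N i ^ (n + 1) = q ^ (2 * (n + 1)) • (x q N i ^ (n + 1) * d q N i) +
      (q ^ (2 * (n + 1)) - 1) • (x q N i ^ n * beta q N i.val) := by
  have hb : beta q N i.val * x q N i = x q N i * beta q N i.val := by
    simpa using beta_mul_x q N i.val i
  induction n with
  | zero => simpa using d_mul_x_self q N i
  | succ n ih =>
    rw [pow_succ, ← mul_assoc, ih, add_mul, smul_mul_assoc, smul_mul_assoc, mul_assoc,
      d_mul_x_self, mul_assoc, hb, mul_add (x q N i ^ (n + 1)), mul_smul_comm, mul_smul_comm, ← mul_assoc,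
      ← mul_assoc, ← pow_succ, ← pow_succ]
    module

theorem d_pow_succ_mul_x (hq : q ≠ 0) (i : Fin N) (n : ℕ) :
    d q N i ^ (n + 1) * x q N i = q ^ (2 * (n + 1)) • (x q N i * d q N i ^ (n + 1)) +
      (q ^ (2 * (n + 1)) - 1) • (beta q N i.val * d q N i ^ n) := by
  have hb : d q N i * beta q N i.val = beta q N i.val * d q N i := by
    simpa using d_mul_beta q N hq i.val i
  induction n with
  | zero => simpa using d_mul_x_self q N i
  | succ n ih =>
    rw [pow_succ', mul_assoc, ih, mul_add, mul_smul_comm, mul_smul_comm, ← mul_assoc,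
      d_mul_x_self, ← mul_assoc, hb, add_mul, smul_mul_assoc, smul_mul_assoc, mul_assoc,
      mul_assoc, ← pow_succ', ← pow_succ']
    module

theorem exists_x_mul_x (hq : q ≠ 0) (i j : Fin N) :
    ∃ c : ℂ, x q N j * x q N i = c • (x q N i * x q N j) ∧ (q ^ ℓ = 1 → c ^ ℓ = 1) := by
  rcases lt_trichotomy i j with h | rfl | h
  · exact ⟨q, x_mul_x q N i j h, id⟩
  · exact ⟨1, (one_smul _ _).symm, fun _ => one_pow _⟩
  · refine ⟨q⁻¹, ?_, fun h => by rw [inv_pow, h, inv_one]⟩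
    rw [x_mul_x q N j i h, smul_smul, inv_mul_cancel₀ hq, one_smul]

theorem exists_d_mul_d (hq : q ≠ 0) (i j : Fin N) :
    ∃ c : ℂ, d q N j * d q N i = c • (d q N i * d q N j) ∧ (q ^ ℓ = 1 → c ^ ℓ = 1) := by
  rcases lt_trichotomy i j with h | rfl | h
  · exact ⟨q⁻¹, d_mul_d q N i j h, fun h => by rw [inv_pow, h, inv_one]⟩
  · exact ⟨1, (one_smul _ _).symm, fun _ => one_pow _⟩
  · refine ⟨q, ?_, id⟩
    rw [d_mul_d q N j i h, smul_smul, mul_inv_cancel₀ hq, one_smul]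

theorem exists_x_mul_orderedMonomial (hq : q ≠ 0) (i : Fin N) (a : Fin N → ℕ) :
    ∃ c : ℂ, x q N i * orderedMonomial (x q N) a =
      c • orderedMonomial (x q N) (a + Pi.single i 1) :=
  exists_mul_orderedMonomial (x q N)
    (fun i j => (exists_x_mul_x (ℓ := 1) hq i j).imp fun _ => And.left) i a

theorem exists_d_mul_orderedMonomial (hq : q ≠ 0) (i : Fin N) (a : Fin N → ℕ) :
    ∃ c : ℂ, d q N i * orderedMonomial (d q N) a =
      c • orderedMonomial (d q N) (a + Pi.single i 1) :=
  exists_mul_orderedMonomial (d q N)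
    (fun i j => (exists_d_mul_d (ℓ := 1) hq i j).imp fun _ => And.left) i a

theorem x_pow_mem_center (hℓ : 0 < ℓ) (hq : IsPrimitiveRoot q ℓ) (i : Fin N) :
    x q N i ^ ℓ ∈ Subalgebra.center ℂ (Dq q N) := by
  have hq0 := hq.ne_zero hℓ.ne'
  refine mem_center_of_comm q N _ (fun j => ?_) (fun j => ?_)
  · obtain ⟨c, h, hc⟩ := exists_x_mul_x (ℓ := ℓ) hq0 i j
    rw [mul_pow_of_qcomm c _ _ h, hc hq.pow_eq_one, one_smul]
  · by_cases hij : j = i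
    · subst hij
      obtain ⟨n, rfl⟩ : ∃ n, ℓ = n + 1 := ⟨ℓ - 1, by omega⟩
      rw [d_mul_x_pow_succ, mul_comm 2, pow_mul, hq.pow_eq_one]
      simp
    · rw [mul_pow_of_qcomm _ _ _ (d_mul_x q N i j hij), hq.pow_eq_one, one_smul]

theorem d_pow_mem_center (hℓ : 0 < ℓ) (hq : IsPrimitiveRoot q ℓ) (i : Fin N) :
    d q N i ^ ℓ ∈ Subalgebra.center ℂ (Dq q N) := by
  have hq0 := hq.ne_zero hℓ.ne'
  refine mem_center_of_comm q N _ (fun j => ?_) (fun j => ?_)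
  · by_cases hij : i = j
    · subst hij
      obtain ⟨n, rfl⟩ : ∃ n, ℓ = n + 1 := ⟨ℓ - 1, by omega⟩
      rw [d_pow_succ_mul_x hq0, mul_comm 2, pow_mul, hq.pow_eq_one]
      simp
    · rw [pow_mul_of_qcomm _ _ _ (d_mul_x q N j i hij), hq.pow_eq_one, one_smul]
  · obtain ⟨c, h, hc⟩ := exists_d_mul_d (ℓ := ℓ) hq0 i j
    rw [mul_pow_of_qcomm c _ _ h, hc hq.pow_eq_one, one_smul]

variable (N) in
/-- The map from the polynomial ring to the centre that sends the variables to the `x_i ^ ℓ` and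
the `∂_i ^ ℓ`. -/
def powHom (hℓ : 0 < ℓ) (hq : IsPrimitiveRoot q ℓ) :
    MvPolynomial (Fin N ⊕ Fin N) ℂ →ₐ[ℂ] Zc q N :=
  MvPolynomial.aeval (Sum.elim (fun i => ⟨x q N i ^ ℓ, x_pow_mem_center hℓ hq i⟩)
    fun i => ⟨d q N i ^ ℓ, d_pow_mem_center hℓ hq i⟩)

/-! ## Spanning by restricted monomials -/

/-- The restricted ordered monomials `x ^ a ∂ ^ b`, with all exponents less than `ℓ`. -/
def restrictedMonomial (q : ℂ) (N ℓ : ℕ) (a : (Fin N → Fin ℓ) × (Fin N → Fin ℓ)) : Dq q N :=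
  orderedMonomial (x q N) (fun i => (a.1 i : ℕ)) * orderedMonomial (d q N) (fun i => (a.2 i : ℕ))

/-- The span contains 1 and is stable under left multiplication by every generator. -/
theorem span_orderedMonomial_eq_top (hq : q ≠ 0) :
    Submodule.span ℂ (Set.range fun a : (Fin N → ℕ) × (Fin N → ℕ) =>
      orderedMonomial (x q N) a.1 * orderedMonomial (d q N) a.2) = ⊤ := by
  set V := Submodule.span ℂ (Set.range fun a : (Fin N → ℕ) × (Fin N → ℕ) =>
      orderedMonomial (x q N) a.1 * orderedMonomial (d q N) a.2) with hV
  have hmem (a b) : orderedMonomial (x q N) a * orderedMonomial (d q N) b ∈ V :=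
    Submodule.subset_span ⟨(a, b), rfl⟩
  have hx (i) (v) (hv : v ∈ V) : x q N i * v ∈ V := by
    induction hv using Submodule.span_induction with
    | mem v hv =>
      obtain ⟨⟨a, b⟩, rfl⟩ := hv
      obtain ⟨c, hc⟩ := exists_x_mul_orderedMonomial hq i a
      simp only
      rw [← mul_assoc, hc, smul_mul_assoc]
      exact V.smul_mem _ (hmem _ _)
    | zero => simp
    | add v w _ _ hv hw => rw [mul_add]; exact V.add_mem hv hw
    | smul c v _ hv => rw [mul_smul_comm]; exact V.smul_mem _ hv
  -- Moving `∂_i` past `x_i` creates the terms `x_k ∂_k` with `k < i`, so the induction on words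
  -- must carry all `∂_i` at once. Words in the `x_j` need not be ordered, so a first letter can
  -- always be stripped.
  have hxs (p) (hp : p ∈ Submonoid.closure (Set.range (x q N))) (b) :
      p * orderedMonomial (d q N) b ∈ V ∧
        ∀ i, d q N i * (p * orderedMonomial (d q N) b) ∈ V := by
    induction hp using Submonoid.closure_induction_left with
    | one =>
      refine ⟨?_, fun i => ?_⟩
      · rw [← orderedMonomial_zero (x q N)]; exact hmem _ _
      · obtain ⟨c, hc⟩ := exists_d_mul_orderedMonomial hq i b
        rw [one_mul, hc, ← one_mul (orderedMonomial _ _), ← orderedMonomial_zero (x q N)]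
        exact V.smul_mem _ (hmem _ _)
    | mul_left y hy p hp ih =>
      obtain ⟨j, rfl⟩ := hy
      rw [mul_assoc]
      refine ⟨hx _ _ ih.1, fun i => ?_⟩
      by_cases hij : i = j
      · subst hij
        rw [← mul_assoc, d_mul_x_self, add_mul, smul_mul_assoc, smul_mul_assoc, beta, add_mul,
          one_mul, Finset.sum_mul, mul_assoc]
        refine V.add_mem (V.smul_mem _ (hx _ _ (ih.2 _))) (V.smul_mem _ (V.add_mem ih.1
          (V.sum_mem fun k _ => ?_)))
        rw [mul_assoc]
        exact hx _ _ (ih.2 _)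
      · rw [← mul_assoc, d_mul_x q N j i hij, smul_mul_assoc, mul_assoc]
        exact V.smul_mem _ (hx _ _ (ih.2 _))
  have hd (i) (v) (hv : v ∈ V) : d q N i * v ∈ V := by
    induction hv using Submodule.span_induction with
    | mem v hv =>
      obtain ⟨⟨a, b⟩, rfl⟩ := hv
      refine (hxs _ ?_ b).2 i
      refine Submonoid.list_prod_mem _ fun y hy => ?_
      obtain ⟨i, rfl⟩ := (List.mem_ofFn' _ _).1 hy
      exact pow_mem (Submonoid.subset_closure (Set.mem_range_self i)) _
    | zero => simp
    | add v w _ _ hv hw => rw [mul_add]; exact V.add_mem hv hw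
    | smul c v _ hv => rw [mul_smul_comm]; exact V.smul_mem _ hv
  have hall (w) : ∀ v ∈ V, mk q N w * v ∈ V := by
    induction w using FreeAlgebra.induction with
    | grade0 r =>
      intro v hv
      rw [AlgHom.commutes, ← Algebra.smul_def]
      exact V.smul_mem _ hv
    | grade1 s =>
      rcases s with i | i
      · exact hx i
      · exact hd i
    | mul a b ha hb => intro v hv; rw [map_mul, mul_assoc]; exact ha _ (hb _ hv)
    | add a b ha hb => intro v hv; rw [map_add, add_mul]; exact V.add_mem (ha _ hv) (hb _ hv)
  have h1 : (1 : Dq q N) ∈ V := by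
    simpa [orderedMonomial_zero] using hmem 0 0
  refine eq_top_iff.2 fun y _ => ?_
  obtain ⟨w, rfl⟩ := mk_surjective q N y
  simpa using hall w 1 h1

theorem exists_eq_sum_powHom_smul (hℓ : 0 < ℓ) (hq : IsPrimitiveRoot q ℓ) (y : Dq q N) :
    ∃ p : (Fin N → Fin ℓ) × (Fin N → Fin ℓ) → MvPolynomial (Fin N ⊕ Fin N) ℂ,
      y = ∑ a, powHom N hℓ hq (p a) • restrictedMonomial q N ℓ a := by
  have hy : y ∈ Submodule.span ℂ _ :=
    (span_orderedMonomial_eq_top (N := N) (hq.ne_zero hℓ.ne')).ge Submodule.mem_top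
  induction hy using Submodule.span_induction with
  | mem v hv =>
    obtain ⟨⟨a, b⟩, rfl⟩ := hv
    -- Division with remainder by `ℓ`: remainders index the restricted monomial, quotients go into
    -- the polynomial coefficient.
    set a' : (Fin N → Fin ℓ) × (Fin N → Fin ℓ) :=
      (fun i => ⟨a i % ℓ, Nat.mod_lt _ hℓ⟩, fun i => ⟨b i % ℓ, Nat.mod_lt _ hℓ⟩) with ha'
    refine ⟨Pi.single a' ((∏ i, MvPolynomial.X (Sum.inl i) ^ (a i / ℓ)) *
      ∏ i, MvPolynomial.X (Sum.inr i) ^ (b i / ℓ)), ?_⟩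
    rw [Finset.sum_eq_single a' (fun c _ hc => by simp [hc]) (by simp), Pi.single_eq_same,
      restrictedMonomial, map_mul, ← smul_mul_smul_comm]
    have h1 := orderedMonomial_mul_add (x q N) ℓ (fun i => powHom N hℓ hq (.X (Sum.inl i)))
      (fun i => by simp [powHom]; rfl) (fun i => a i % ℓ) (fun i => a i / ℓ)
    have h2 := orderedMonomial_mul_add (d q N) ℓ (fun i => powHom N hℓ hq (.X (Sum.inr i)))
      (fun i => by simp [powHom]; rfl) (fun i => b i % ℓ) (fun i => b i / ℓ)
    simp only [Nat.div_add_mod] at h1 h2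
    simp only [map_prod, map_pow, ha']
    rw [← h1, ← h2]
  | zero => exact ⟨0, by simp⟩
  | add v w _ _ hv hw =>
    obtain ⟨p, rfl⟩ := hv
    obtain ⟨p', rfl⟩ := hw
    exact ⟨p + p', by simp [add_smul, Finset.sum_add_distrib]⟩
  | smul c v _ hv =>
    obtain ⟨p, rfl⟩ := hv
    exact ⟨c • p, by simp [Finset.smul_sum]⟩

end QDiff

/-! ## Finite-dimensional algebras whose modules are large -/

/-- A simple module over an algebra that is finite-dimensional over an algebraically closed field
realizes all linear endomorphisms. -/
theorem IsSimpleModule.lsmul_surjective_of_isAlgClosed (K F S : Type*) [Field K] [IsAlgClosed K]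
    [Ring F] [Algebra K F] [AddCommGroup S] [Module K S] [Module F S] [IsScalarTower K F S]
    [FiniteDimensional K S] [IsSimpleModule F S] :
    Function.Surjective (Algebra.lsmul K K S : F →ₐ[K] Module.End K S) := by
  classical
  have : Module.Finite K (Module.End F S) :=
    Module.Finite.of_injective (LinearMap.restrictScalarsₗ K F S S K)
      (LinearMap.restrictScalars_injective K)
  -- Schur: the commutant is a finite-dimensional division algebra over `K`, hence `K` itself. Every
  -- `K`-linear map is therefore linear over the commutant, and density applies to it.
  have hbij : Function.Bijective (algebraMap K (Module.End F S)) :=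
    IsAlgClosed.algebraMap_bijective_of_isIntegral
  intro f
  let g : Module.End (Module.End F S) S :=
    { toFun := f
      map_add' := f.map_add
      map_smul' := fun c v => by
        obtain ⟨k, rfl⟩ := hbij.2 c
        simp }
  let b := Module.finBasis K S
  obtain ⟨r, hr⟩ := jacobson_density (R := F) g (Finset.univ.image b)
  refine ⟨r, b.ext fun i => ?_⟩
  exact (hr (b i) (Finset.mem_image_of_mem _ (Finset.mem_univ i))).symm

/-- An algebra of dimension at most `d ^ 2`, all of whose nonzero modules have dimension at least
`d`, is a matrix algebra. -/
theorem nonempty_algEquiv_matrix_of_le_finrank (K F : Type) [Field K] [IsAlgClosed K]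
    [Ring F] [Algebra K F] [Nontrivial F] [FiniteDimensional K F] (n : ℕ)
    (hF : Module.finrank K F ≤ n * n)
    (hM : ∀ (S : Type) [AddCommGroup S] [Module K S] [Module F S] [IsScalarTower K F S]
      [FiniteDimensional K S] [Nontrivial S], n ≤ Module.finrank K S) :
    Nonempty (F ≃ₐ[K] Matrix (Fin n) (Fin n) K) := by
  obtain ⟨I, hI⟩ := Ideal.exists_maximal F
  have : IsSimpleModule F (F ⧸ I) := isSimpleModule_iff_isCoatom.2 hI.out
  have : Nontrivial (F ⧸ I) := IsSimpleModule.nontrivial F _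
  have : Module.Finite K (F ⧸ I) :=
    Module.Finite.of_surjective (I.mkQ.restrictScalars K) I.mkQ_surjective
  have hsurj := IsSimpleModule.lsmul_surjective_of_isAlgClosed K F (F ⧸ I)
  have hn := hM (F ⧸ I)
  have hle := LinearMap.finrank_le_finrank_of_surjective
    (f := (Algebra.lsmul K K (F ⧸ I) : F →ₐ[K] _).toLinearMap) hsurj
  rw [Module.finrank_linearMap] at hle
  -- With `d` the dimension of the simple module, `d ^ 2 ≤ dim F ≤ n ^ 2` and `n ≤ d`.
  have hd : Module.finrank K (F ⧸ I) = n := by nlinarith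
  have heq : Module.finrank K F = Module.finrank K (Module.End K (F ⧸ I)) := by
    rw [Module.finrank_linearMap]
    rw [hd] at hle ⊢
    exact le_antisymm hF hle
  have hinj := (LinearMap.injective_iff_surjective_of_finrank_eq_finrank heq
    (f := (Algebra.lsmul K K (F ⧸ I) : F →ₐ[K] _).toLinearMap)).2 hsurj
  exact ⟨(AlgEquiv.ofBijective _ ⟨hinj, hsurj⟩).trans
    (algEquivMatrix (Module.finBasisOfFinrankEq K (F ⧸ I) hd))⟩

/-! ### Joint weights of the `β_k` in modules. -/

namespace QDiff

variable {q : ℂ} {N ℓ : ℕ}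

theorem beta_eq_of_le (k : ℕ) (h : N ≤ k) : beta q N k = beta q N N := by
  induction k, h using Nat.le_induction with
  | base => rfl
  | succ k h ih => rw [beta_succ_of_le q N k h, ih]

theorem beta_commute (hq : q ≠ 0) (j k : ℕ) : Commute (beta q N j) (beta q N k) := by
  refine Commute.add_left (Commute.one_left _) (Commute.sum_left _ _ _ fun i _ => ?_)
  rw [commute_iff_eq, mul_assoc, d_mul_beta q N hq, mul_smul_comm, ← mul_assoc, ← mul_assoc,
    beta_mul_x, smul_mul_assoc]

section Weights

variable {K F M : Type} [Field K] [Ring F] [Algebra K F] [Algebra ℂ F] [AddCommGroup M]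
  [Module K M] [Module F M] [IsScalarTower K F M]

/-- The weight `b` occurs in the `D_q(ℂ^N)`-module `M`: there is a nonzero common eigenvector of
the `β_k` with eigenvalues `b k`. -/
def HasWeight (K M : Type) {F : Type} [Field K] [Ring F] [Algebra ℂ F]
    [AddCommGroup M] [Module K M] [Module F M]
    (ψ : Dq q N →ₐ[ℂ] F) (b : ℕ → K) : Prop :=
  ∃ v : M, v ≠ 0 ∧ ∀ k, ψ (beta q N k) • v = b k • v

/-- Each further `β` preserves the joint eigenspace of the earlier ones and so has an eigenvector in
it. The process stops at `N`, beyond which the `β_k` are constant. -/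
theorem exists_hasWeight [IsAlgClosed K] [FiniteDimensional K M] [Nontrivial M]
    (hq : q ≠ 0) (ψ : Dq q N →ₐ[ℂ] F) : ∃ b : ℕ → K, HasWeight K M ψ b := by
  have key (n : ℕ) : ∃ (b : ℕ → K) (v : M), v ≠ 0 ∧
      ∀ k ≤ n, ψ (beta q N k) • v = b k • v := by
    induction n with
    | zero =>
      obtain ⟨v, hv⟩ := exists_ne (0 : M)
      refine ⟨fun _ => 1, v, hv, fun k hk => ?_⟩
      obtain rfl : k = 0 := by omega
      simp [beta]
    | succ n ih =>
      obtain ⟨b, v, hv, hb⟩ := ih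
      let W : Submodule K M := ⨅ k : Fin (n + 1),
        Module.End.eigenspace (Algebra.lsmul K K M (ψ (beta q N k))) (b k)
      have hW (w : M) : w ∈ W ↔ ∀ k ≤ n, ψ (beta q N k) • w = b k • w := by
        simp only [W, Submodule.mem_iInf, Module.End.mem_eigenspace_iff, Algebra.lsmul_coe]
        exact ⟨fun h k hk => h ⟨k, by omega⟩, fun h k => h k (by omega)⟩
      have hmaps : ∀ w ∈ W, Algebra.lsmul K K M (ψ (beta q N (n + 1))) w ∈ W := by
        intro w hw
        rw [hW] at hw ⊢
        intro k hk
        rw [Algebra.lsmul_coe, smul_smul, ← map_mul, (beta_commute hq k (n + 1)).eq, map_mul,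
          mul_smul, hw k hk, smul_algebra_smul_comm]
      have : Nontrivial W :=
        ⟨⟨⟨v, (hW v).2 hb⟩, 0, fun h => hv (congrArg Subtype.val h)⟩⟩
      obtain ⟨c, hc⟩ := Module.End.exists_eigenvalue
        ((Algebra.lsmul K K M (ψ (beta q N (n + 1)))).restrict hmaps)
      obtain ⟨w, hw⟩ := hc.exists_hasEigenvector
      refine ⟨Function.update b (n + 1) c, w, fun h => hw.2 (Subtype.ext h), fun k hk => ?_⟩
      rcases Nat.lt_or_eq_of_le hk with hk | rfl
      · rw [Function.update_of_ne hk.ne]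
        exact (hW w).1 w.2 k (by omega)
      · rw [Function.update_self]
        exact congrArg Subtype.val hw.apply_eq_smul
  obtain ⟨b, v, hv, hb⟩ := key N
  refine ⟨fun k => b (min k N), v, hv, fun k => ?_⟩
  rcases le_total k N with h | h
  · simp only [min_eq_left h]; exact hb k h
  · simp only [min_eq_right h, beta_eq_of_le k h]; exact hb N le_rfl

theorem HasWeight.ne_zero {ψ : Dq q N →ₐ[ℂ] F} {b : ℕ → K} (hb : HasWeight K M ψ b)
    (hβ : ∀ k, ∃ c : K, c ≠ 0 ∧ ψ (beta q N k) ^ ℓ = algebraMap K F c) (hℓ : ℓ ≠ 0) (k : ℕ) :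
    b k ≠ 0 := by
  obtain ⟨v, hv, hvb⟩ := hb
  obtain ⟨c, hc, hck⟩ := hβ k
  have h (n : ℕ) : ψ (beta q N k) ^ n • v = b k ^ n • v := by
    induction n with
    | zero => simp
    | succ n ih => rw [pow_succ, mul_smul, hvb, smul_algebra_smul_comm, ih, smul_smul, pow_succ']
  intro h0
  have h1 := h ℓ
  rw [hck, algebraMap_smul, h0, zero_pow hℓ, zero_smul, smul_eq_zero_iff_left hv] at h1
  exact hc h1

variable [Algebra ℂ K] [IsScalarTower ℂ K F]

theorem map_smul_smul (ψ : Dq q N →ₐ[ℂ] F) (c : ℂ) (y : Dq q N) (v : M) :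
    ψ (c • y) • v = algebraMap ℂ K c • ψ y • v := by
  rw [map_smul, ← algebraMap_smul K c (ψ y), smul_assoc]

/-- If `x_i v ≠ 0`, it has the shifted weight. Otherwise `∂_i ^ (ℓ - 1) v` does: `∂_i` divides the
relevant eigenvalues by `q ^ 2`, and `ℓ - 1` such divisions amount to one multiplication by `q ^ 2`.
-/
theorem HasWeight.shift (hℓ : 1 < ℓ) (hodd : Odd ℓ) (hq : IsPrimitiveRoot q ℓ)
    {ψ : Dq q N →ₐ[ℂ] F} {b : ℕ → K} (hb0 : ∀ k, b k ≠ 0) (hb : HasWeight K M ψ b) (i : Fin N) :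
    HasWeight K M ψ (fun k => (if i.val < k then algebraMap ℂ K q ^ 2 else 1) * b k) := by
  obtain ⟨v, hv, hvb⟩ := hb
  have hq0 : q ≠ 0 := hq.ne_zero (by omega)
  set Q : K := algebraMap ℂ K q with hQ
  have hQp : IsPrimitiveRoot Q ℓ := hq.map_of_injective (algebraMap ℂ K).injective
  have hQ2 : IsPrimitiveRoot (Q ^ 2) ℓ :=
    hQp.pow_of_coprime 2 (Nat.coprime_two_left.2 hodd)
  have hQ0 : Q ≠ 0 := hQp.ne_zero (by omega)
  have hif (k : ℕ) : algebraMap ℂ K (if i.val < k then q ^ 2 else 1) =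
      if i.val < k then Q ^ 2 else 1 := by
    split_ifs <;> simp [hQ]
  by_cases hxv : ψ (x q N i) • v = 0
  · have h1 : Q ^ 2 * b (i + 1) = b i := by
      have h := congrArg (fun w => ψ (d q N i) • w) hxv
      simp only [smul_zero] at h
      have e : d q N i * x q N i = q ^ 2 • beta q N (i + 1) - beta q N i := by
        rw [d_mul_x_self, beta_succ]; module
      rw [smul_smul, ← map_mul, e, map_sub, sub_smul, map_smul_smul (K := K), hvb, hvb, smul_smul,
        ← sub_smul, smul_eq_zero_iff_left hv, map_pow, sub_eq_zero] at h
      exact h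
    have key (t : ℕ) (ht : t < ℓ) : ψ (d q N i) ^ t • v ≠ 0 ∧ ∀ k,
        ψ (beta q N k) • ψ (d q N i) ^ t • v =
          ((if i.val < k then ((Q ^ 2)⁻¹) ^ t else 1) * b k) • ψ (d q N i) ^ t • v := by
      induction t with
      | zero => simpa using ⟨hv, hvb⟩
      | succ t ih =>
        obtain ⟨ih1, ih2⟩ := ih (by omega)
        rw [pow_succ', mul_smul]
        set w := ψ (d q N i) ^ t • v with hw
        refine ⟨fun h0 => ?_, fun k => ?_⟩
        -- On `w`, `x_i ∂_i = β_{i+1} - β_i` acts by `Q ^ (-2t) b_{i+1} - b_i = (Q ^ (-2t) - Q ^ 2)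
        -- b_{i+1}`, using `h1`. This vanishes only if `(Q ^ 2) ^ (t + 1) = 1`, impossible for `t +
        -- 1 < ℓ`.
        · have h := congrArg (fun w => ψ (x q N i) • w) h0
          simp only [smul_zero] at h
          have e : x q N i * d q N i = beta q N (i + 1) - beta q N i := by
            rw [beta_succ]; abel
          rw [smul_smul, ← map_mul, e, map_sub, sub_smul, ih2, ih2, ← sub_smul,
            smul_eq_zero_iff_left ih1, if_pos (by omega), if_neg (by omega), one_mul, sub_eq_zero,
            ← h1, mul_comm, mul_comm (Q ^ 2)] at h
          have h3 := mul_left_cancel₀ (hb0 _) h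
          rw [inv_pow, inv_eq_iff_eq_inv] at h3
          have h4 : (Q ^ 2) ^ (t + 1) = 1 := by
            rw [pow_succ, h3, inv_mul_cancel₀ (pow_ne_zero _ hQ0)]
          exact hQ2.pow_ne_one_of_pos_of_lt (by omega) ht h4
        · have e := d_mul_beta q N hq0 k i
          have h := congrArg (fun y => ψ y • w) e
          simp only [map_mul] at h
          rw [map_smul_smul (K := K), hif, map_mul, mul_smul, mul_smul, ih2,
            smul_algebra_smul_comm] at h
          split_ifs with hk
          · rw [if_pos hk, if_pos hk] at h
            rw [pow_succ', mul_assoc, mul_smul, h, smul_smul (Q ^ 2)⁻¹, inv_mul_cancel₀ (pow_ne_zero _ hQ0),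
              one_smul]
          · rw [if_neg hk, if_neg hk, one_smul] at h
            exact h.symm
    obtain ⟨h2, h3⟩ := key (ℓ - 1) (by omega)
    refine ⟨_, h2, fun k => ?_⟩
    rw [h3]
    congr 3
    have : (Q ^ 2) ^ (ℓ - 1) * Q ^ 2 = 1 := by
      rw [← pow_succ, Nat.sub_add_cancel hℓ.le, hQ2.pow_eq_one]
    rw [inv_pow, inv_eq_of_mul_eq_one_right this]
  · refine ⟨_, hxv, fun k => ?_⟩
    have h := congrArg (fun y => ψ y • v) (beta_mul_x q N k i)
    simp only [map_mul] at h
    rw [map_smul_smul (K := K), hif, map_mul, mul_smul, mul_smul, hvb,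
      smul_algebra_smul_comm] at h
    exact h.trans (smul_smul _ _ _)

theorem HasWeight.shift_all (hℓ : 1 < ℓ) (hodd : Odd ℓ) (hq : IsPrimitiveRoot q ℓ)
    {ψ : Dq q N →ₐ[ℂ] F} {b : ℕ → K}
    (hβ : ∀ k, ∃ c : K, c ≠ 0 ∧ ψ (beta q N k) ^ ℓ = algebraMap K F c)
    (hb : HasWeight K M ψ b) (m : Fin N → ℕ) :
    HasWeight K M ψ
      (fun k => (algebraMap ℂ K q ^ 2) ^ (∑ j : Fin N with j.val < k, m j) * b k) := by
  induction hs : ∑ i, m i generalizing m with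
  | zero =>
    obtain rfl : m = 0 := by
      funext i
      exact (Finset.sum_eq_zero_iff.1 hs) i (Finset.mem_univ i)
    simpa using hb
  | succ s ih =>
    obtain ⟨i, hi⟩ : ∃ i, m i ≠ 0 := by
      by_contra! h
      simp [h] at hs
    obtain ⟨m', rfl⟩ : ∃ m' : Fin N → ℕ, m = m' + Pi.single i 1 := by
      refine ⟨m - Pi.single i 1, funext fun k => ?_⟩
      rw [Pi.add_apply, Pi.sub_apply]
      by_cases hk : k = i
      · subst hk; simp; omega
      · simp [hk]
    have h1 := ih m' (by simpa [Finset.sum_add_distrib] using hs)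
    have h2 := h1.shift hℓ hodd hq (h1.ne_zero hβ (by omega)) i
    convert h2 using 2 with k
    rw [← mul_assoc]
    congr 1
    simp only [Pi.add_apply, Finset.sum_add_distrib, Finset.sum_pi_single', Finset.mem_filter,
      Finset.mem_univ, true_and]
    split_ifs <;> simp [pow_succ']

/-- The weights obtained from exponents `m i < ℓ` are distinct: the ratio of the eigenvalues at `i +
1` and `i` recovers `(q ^ 2) ^ m i`, hence `m i`. Vectors of distinct joint weights are independent.
-/
theorem pow_le_finrank [IsAlgClosed K] [FiniteDimensional K M] [Nontrivial M]
    (hℓ : 1 < ℓ) (hodd : Odd ℓ) (hq : IsPrimitiveRoot q ℓ) (ψ : Dq q N →ₐ[ℂ] F)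
    (hβ : ∀ k, ∃ c : K, c ≠ 0 ∧ ψ (beta q N k) ^ ℓ = algebraMap K F c) :
    ℓ ^ N ≤ Module.finrank K M := by
  have hq0 : q ≠ 0 := hq.ne_zero (by omega)
  obtain ⟨b, hb⟩ := exists_hasWeight (K := K) (M := M) hq0 ψ
  have hQ2 : IsPrimitiveRoot (algebraMap ℂ K q ^ 2) ℓ :=
    (hq.map_of_injective (algebraMap ℂ K).injective).pow_of_coprime 2
      (Nat.coprime_two_left.2 hodd)
  set f : ℕ → Module.End K M := fun k => Algebra.lsmul K K M (ψ (beta q N k)) with hf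
  have hcomm (j k : ℕ) : Commute (f j) (f k) :=
    ((beta_commute hq0 j k).map ψ).map (Algebra.lsmul K K M)
  have hind := Module.End.independent_iInf_maxGenEigenspace_of_forall_mapsTo f
    fun i j c => Module.End.mapsTo_maxGenEigenspace_of_comm (hcomm j i) c
  let w (m : Fin N → Fin ℓ) : ℕ → K := fun k =>
    (algebraMap ℂ K q ^ 2) ^ (∑ j : Fin N with j.val < k, (m j : ℕ)) * b k
  have hw : Function.Injective w := by
    intro m m' h
    have hS (k : ℕ) : (algebraMap ℂ K q ^ 2) ^ (∑ j : Fin N with j.val < k, (m j : ℕ)) =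
        (algebraMap ℂ K q ^ 2) ^ (∑ j : Fin N with j.val < k, (m' j : ℕ)) :=
      mul_right_cancel₀ (hb.ne_zero hβ (by omega) k) (congrFun h k)
    funext i
    have e : (Finset.univ.filter fun j : Fin N => j.val < i.val + 1) =
        insert i (Finset.univ.filter fun j : Fin N => j.val < i.val) := by
      ext j; simp [Fin.ext_iff]; omega
    have h1 := hS (i + 1)
    rw [e, Finset.sum_insert (by simp), Finset.sum_insert (by simp), pow_add, pow_add, hS i] at h1
    have h2 := mul_right_cancel₀ (pow_ne_zero _ (hQ2.ne_zero (by omega))) h1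
    exact Fin.ext (hQ2.pow_inj (m i).2 (m' i).2 h2)
  choose v hv hvw using fun m : Fin N → Fin ℓ => hb.shift_all hℓ hodd hq hβ (fun i => (m i : ℕ))
  have hlin : LinearIndependent K v := by
    refine (hind.comp hw).linearIndependent _ (fun m => ?_) hv
    simp only [Function.comp_apply, Submodule.mem_iInf]
    intro k
    refine Module.End.genEigenspace_le_maximal _ _ 1 ?_
    exact Module.End.mem_eigenspace_iff.2 (hvw m k)
  simpa using hlin.fintype_card_le_finrank

end Weights

/-- A nonzero finite-dimensional algebra of dimension at most `ℓ ^ (2 * N)`, with a homomorphism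
from `D_q(ℂ^N)` for which the `β_k ^ ℓ` are nonzero scalars, is a matrix algebra. -/
theorem nonempty_algEquiv_matrix {K F : Type} [Field K] [IsAlgClosed K] [Algebra ℂ K] [Ring F]
    [Algebra K F] [Algebra ℂ F] [IsScalarTower ℂ K F] [Nontrivial F] [FiniteDimensional K F]
    (hℓ : 1 < ℓ) (hodd : Odd ℓ) (hq : IsPrimitiveRoot q ℓ) (ψ : Dq q N →ₐ[ℂ] F)
    (hβ : ∀ k, ∃ c : K, c ≠ 0 ∧ ψ (beta q N k) ^ ℓ = algebraMap K F c)
    (hF : Module.finrank K F ≤ ℓ ^ N * ℓ ^ N) :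
    Nonempty (F ≃ₐ[K] Matrix (Fin (ℓ ^ N)) (Fin (ℓ ^ N)) K) := by
  refine nonempty_algEquiv_matrix_of_le_finrank K F _ hF ?_
  intro S _ _ _ _ _ _
  exact pow_le_finrank hℓ hodd hq ψ hβ

end QDiff

/-! ## Weighted shifts on functions on a group -/

section WeightedShift

variable {G K : Type} [AddCommGroup G] [Field K]

/-- The operator `f ↦ (m ↦ c m * f (m + v))` on functions. -/
def weightedShift (c : G → K) (v : G) : Module.End K (G → K) where
  toFun f m := c m * f (m + v)
  map_add' f g := by ext m; simp [mul_add]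
  map_smul' a f := by ext m; simp [mul_left_comm]

theorem weightedShift_apply (c : G → K) (v : G) (f : G → K) (m : G) :
    weightedShift c v f m = c m * f (m + v) := rfl

theorem weightedShift_congr {c c' : G → K} {v v' : G}
    (hc : ∀ m, c m = c' m) (hv : v = v') : weightedShift c v = weightedShift c' v' := by
  rw [funext hc, hv]

theorem weightedShift_mul (c c' : G → K) (v v' : G) :
    weightedShift c v * weightedShift c' v' =
      weightedShift (fun m => c m * c' (m + v)) (v + v') := by
  ext1 f
  funext m
  simp only [Module.End.mul_apply, weightedShift_apply, mul_assoc, add_assoc]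

theorem weightedShift_zero_eq_algebraMap (a : K) :
    weightedShift (fun _ : G => a) 0 = algebraMap K _ a := by
  ext1 f
  funext m
  simp [weightedShift_apply, Module.algebraMap_end_apply]

theorem weightedShift_add (c c' : G → K) (v : G) :
    weightedShift c v + weightedShift c' v = weightedShift (fun m => c m + c' m) v := by
  ext1 f
  funext m
  simp [weightedShift_apply, add_mul]

theorem smul_weightedShift [Algebra ℂ K] (a : ℂ) (c : G → K) (v : G) :
    a • weightedShift c v = weightedShift (fun m => algebraMap ℂ K a * c m) v := by
  ext1 f
  funext m
  simp [weightedShift_apply, Algebra.smul_def, mul_assoc]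

theorem weightedShift_pow (c : G → K) (v : G) (n : ℕ) :
    weightedShift c v ^ n =
      weightedShift (fun m => ∏ s ∈ Finset.range n, c (m + s • v)) (n • v) := by
  induction n with
  | zero => simpa using (weightedShift_zero_eq_algebraMap (G := G) (1 : K)).symm
  | succ n ih =>
    rw [pow_succ, ih, weightedShift_mul, succ_nsmul]
    simp only [Finset.prod_range_succ]

end WeightedShift

/-- The powers `ζ ^ (s + 1)` run through all `n`-th roots of unity, so this is the factorization of
`y ^ n - x ^ n` up to the sign `(-1) ^ n = -1`. It serves to compute the `ℓ`-th power of `dOp`. -/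
theorem IsPrimitiveRoot.prod_pow_succ_mul_sub {K : Type*} [Field K] {ζ : K} {n : ℕ}
    (hn : Odd n) (hζ : IsPrimitiveRoot ζ n) (x y : K) :
    ∏ s ∈ Finset.range n, (ζ ^ (s + 1) * x - y) = x ^ n - y ^ n := by
  have hpos : 0 < n := hn.pos
  have h1 : ∏ s ∈ Finset.range n, (ζ ^ (s + 1) * x - y) =
      ∏ s ∈ Finset.range n, (ζ ^ s * x - y) := by
    obtain ⟨m, rfl⟩ : ∃ m, n = m + 1 := ⟨n - 1, by omega⟩
    rw [Finset.prod_range_succ, Finset.prod_range_succ', hζ.pow_eq_one, pow_zero]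
  have h2 : ∏ s ∈ Finset.range n, (ζ ^ s * x - y) =
      ∏ μ ∈ Polynomial.nthRootsFinset n (1 : K), (μ * x - y) := by
    have hz : NeZero n := ⟨hpos.ne'⟩
    refine Finset.prod_bij (fun s _ => ζ ^ s) (fun s _ => ?_) (fun s hs s' hs' h => ?_)
      (fun μ hμ => ?_) (fun _ _ => rfl)
    · rw [Polynomial.mem_nthRootsFinset hpos, ← pow_mul, mul_comm, pow_mul, hζ.pow_eq_one,
        one_pow]
    · exact hζ.pow_inj (Finset.mem_range.1 hs) (Finset.mem_range.1 hs') h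
    · obtain ⟨i, hi, rfl⟩ :=
        hζ.eq_pow_of_pow_eq_one ((Polynomial.mem_nthRootsFinset hpos _).1 hμ)
      exact ⟨i, Finset.mem_range.2 hi, rfl⟩
  have h3 := hζ.pow_sub_pow_eq_prod_sub_mul y x hpos
  rw [h1, h2, ← neg_sub, h3]
  simp only [← neg_sub y]
  rw [Finset.prod_neg, hζ.card_nthRootsFinset, hn.neg_one_pow, neg_one_mul]

namespace QDiff

variable {q : ℂ} {N ℓ : ℕ}

/-! ## A family of representations -/

section Representation

variable {K : Type} [Field K] [Algebra ℂ K]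

/-- The character `q ^ (m_0 + ⋯ + m_{k-1})` of `(ℤ/ℓ)^N`. -/
def partialChar (K : Type) [Field K] [Algebra ℂ K] [NeZero ℓ] (hq : IsPrimitiveRoot q ℓ) (k : ℕ)
    (m : Fin N → ZMod ℓ) : K :=
  AddChar.zmodChar ℓ (hq.map_of_injective (algebraMap ℂ K).injective).pow_eq_one
    (∑ j : Fin N with j.val < k, m j)

variable [NeZero ℓ] (hq : IsPrimitiveRoot q ℓ)

theorem partialChar_ne_zero (k : ℕ) (m : Fin N → ZMod ℓ) : partialChar K hq k m ≠ 0 := by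
  rw [partialChar, AddChar.zmodChar_apply]
  exact pow_ne_zero _ ((hq.map_of_injective (algebraMap ℂ K).injective).ne_zero (NeZero.ne ℓ))

theorem partialChar_pow (k : ℕ) (m : Fin N → ZMod ℓ) : partialChar K hq k m ^ ℓ = 1 := by
  rw [partialChar, AddChar.zmodChar_apply, ← pow_mul, mul_comm, pow_mul,
    (hq.map_of_injective (algebraMap ℂ K).injective).pow_eq_one, one_pow]

theorem partialChar_zero (m : Fin N → ZMod ℓ) : partialChar K hq 0 m = 1 := by
  simp [partialChar]

theorem partialChar_add_single (hℓ : 1 < ℓ) (k : ℕ) (m : Fin N → ZMod ℓ) (j : Fin N) :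
    partialChar K hq k (m + Pi.single j 1) =
      (if j.val < k then algebraMap ℂ K q else 1) * partialChar K hq k m := by
  have : Fact (1 < ℓ) := ⟨hℓ⟩
  have e : ∑ i : Fin N with i.val < k, (m + Pi.single j 1 : Fin N → ZMod ℓ) i =
      (∑ i : Fin N with i.val < k, m i) + if j.val < k then 1 else 0 := by
    simp [Finset.sum_add_distrib, Finset.sum_pi_single']
  rw [partialChar, e, AddChar.map_add_eq_mul, mul_comm]
  congr 1
  split_ifs
  · rw [AddChar.zmodChar_apply, ZMod.val_one, pow_one]
  · rw [AddChar.map_zero_eq_one]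

theorem partialChar_sub_single (hℓ : 1 < ℓ) (k : ℕ) (m : Fin N → ZMod ℓ) (j : Fin N) :
    partialChar K hq k (m + -Pi.single j 1) =
      (if j.val < k then (algebraMap ℂ K q)⁻¹ else 1) * partialChar K hq k m := by
  have h := partialChar_add_single (K := K) hq hℓ k (m + -Pi.single j 1) j
  rw [neg_add_cancel_right] at h
  rw [h]
  have hQ := (hq.map_of_injective (algebraMap ℂ K).injective).ne_zero (NeZero.ne ℓ)
  split_ifs <;> simp [hQ]

variable (u : Fin N → K) (t : ℕ → K)

/-- The operator by which `x_i` acts. -/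
def xOp (i : Fin N) : Module.End K ((Fin N → ZMod ℓ) → K) :=
  weightedShift (fun m => u i * partialChar K hq i.val m) (-Pi.single i 1)

/-- The operator by which `∂_i` acts. -/
def dOp (i : Fin N) : Module.End K ((Fin N → ZMod ℓ) → K) :=
  weightedShift (fun m => (u i)⁻¹ * (partialChar K hq i.val m)⁻¹ *
    (algebraMap ℂ K q ^ 2 * partialChar K hq (i.val + 1) m ^ 2 * t (i.val + 1) -
      partialChar K hq i.val m ^ 2 * t i.val)) (Pi.single i 1)

/-- The operator by which `β_k` acts. -/
def betaOp (k : ℕ) : Module.End K ((Fin N → ZMod ℓ) → K) :=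
  weightedShift (fun m => partialChar K hq k m ^ 2 * t k) 0

variable {u}

/-- This identity dictates the weight in `dOp`: with `x_i` a shift and `β_k` diagonal, `∂_i` is
forced by `x_i ∂_i = β_{i+1} - β_i`. The factor `q ^ 2` there compensates for evaluating the weight
at `m - e_i`. -/
theorem betaOp_add_xOp_mul_dOp (hu : ∀ i, u i ≠ 0) (hℓ : 1 < ℓ) (i : Fin N) :
    betaOp hq t i.val + xOp hq u i * dOp hq u t i = betaOp hq t (i.val + 1) := by
  have hQ := (hq.map_of_injective (algebraMap ℂ K).injective).ne_zero (NeZero.ne ℓ)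
  have hp := partialChar_ne_zero (K := K) (N := N) hq
  rw [xOp, dOp, betaOp, betaOp, weightedShift_mul, neg_add_cancel, weightedShift_add]
  refine weightedShift_congr (fun m => ?_) rfl
  simp only [partialChar_sub_single hq hℓ]
  have := hu i
  have := hp i.val m
  simp
  field_simp
  ring

theorem dOp_mul_xOp_self (hu : ∀ i, u i ≠ 0) (hℓ : 1 < ℓ) (i : Fin N) :
    dOp hq u t i * xOp hq u i =
      q ^ 2 • (xOp hq u i * dOp hq u t i) + (q ^ 2 - 1) • betaOp hq t i.val := by
  have hQ := (hq.map_of_injective (algebraMap ℂ K).injective).ne_zero (NeZero.ne ℓ)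
  have hp := partialChar_ne_zero (K := K) (N := N) hq
  rw [xOp, dOp, betaOp, weightedShift_mul, weightedShift_mul, neg_add_cancel, add_neg_cancel,
    smul_weightedShift, smul_weightedShift, weightedShift_add]
  refine weightedShift_congr (fun m => ?_) rfl
  simp only [partialChar_sub_single hq hℓ, partialChar_add_single hq hℓ]
  have := hu i
  have := hp i.val m
  simp
  field_simp
  ring

theorem dOp_mul_xOp (hu : ∀ i, u i ≠ 0) (hℓ : 1 < ℓ) (i j : Fin N) (h : j ≠ i) :
    dOp hq u t j * xOp hq u i = q • (xOp hq u i * dOp hq u t j) := by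
  have hQ := (hq.map_of_injective (algebraMap ℂ K).injective).ne_zero (NeZero.ne ℓ)
  have hp := partialChar_ne_zero (K := K) (N := N) hq
  rw [xOp, dOp, weightedShift_mul, weightedShift_mul, smul_weightedShift]
  refine weightedShift_congr (fun m => ?_) (add_comm _ _)
  simp only [partialChar_sub_single hq hℓ, partialChar_add_single hq hℓ]
  have := hu i
  have := hu j
  have := hp i.val m
  have := hp j.val m
  rcases lt_or_gt_of_ne (fun e => h (Fin.ext e) : j.val ≠ i.val) with h | h
  · rw [if_pos h, if_neg (by omega), if_neg (by omega)]
    field_simp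
  · rw [if_neg (by omega), if_pos h, if_pos (by omega)]
    field_simp

theorem dOp_mul_dOp (hu : ∀ i, u i ≠ 0) (hℓ : 1 < ℓ) (i j : Fin N) (h : i < j) :
    dOp hq u t j * dOp hq u t i = q⁻¹ • (dOp hq u t i * dOp hq u t j) := by
  have hQ := (hq.map_of_injective (algebraMap ℂ K).injective).ne_zero (NeZero.ne ℓ)
  have hp := partialChar_ne_zero (K := K) (N := N) hq
  have h' : i.val < j.val := h
  rw [dOp, dOp, weightedShift_mul, weightedShift_mul, smul_weightedShift]
  refine weightedShift_congr (fun m => ?_) (add_comm _ _)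
  simp only [partialChar_add_single hq hℓ]
  have := hu i
  have := hu j
  have := hp i.val m
  have := hp j.val m
  rw [if_neg (by omega), if_neg (by omega), if_pos h', if_pos (by omega), map_inv₀]
  field_simp

theorem xOp_mul_xOp (hℓ : 1 < ℓ) (i j : Fin N) (h : i < j) :
    xOp hq u j * xOp hq u i = q • (xOp hq u i * xOp hq u j) := by
  have hQ := (hq.map_of_injective (algebraMap ℂ K).injective).ne_zero (NeZero.ne ℓ)
  have h' : i.val < j.val := h
  rw [xOp, xOp, weightedShift_mul, weightedShift_mul, smul_weightedShift]
  refine weightedShift_congr (fun m => ?_) (add_comm _ _)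
  simp only [partialChar_sub_single hq hℓ]
  rw [if_neg (by omega), if_pos h']
  field_simp

theorem xOp_pow (hℓ : 1 < ℓ) (i : Fin N) : xOp hq u i ^ ℓ = algebraMap K _ (u i ^ ℓ) := by
  rw [xOp, weightedShift_pow, ← weightedShift_zero_eq_algebraMap]
  refine weightedShift_congr (fun m => ?_) (by ext; simp)
  have h (s : ℕ) : partialChar K hq i.val (m + s • -Pi.single i 1) = partialChar K hq i.val m := by
    induction s with
    | zero => simp
    | succ s ih => rw [succ_nsmul, ← add_assoc, partialChar_sub_single hq hℓ, ih]; simp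
  simp only [h, Finset.prod_const, Finset.card_range, mul_pow, partialChar_pow, mul_one]

/-- Along an orbit of translation by `e_i` only the term with index `i + 1` varies, by powers of `q
^ 2`, so the product of the weights over the orbit is a difference of `ℓ`-th powers. -/
theorem dOp_pow (hℓ : 1 < ℓ) (hodd : Odd ℓ) (i : Fin N) :
    dOp hq u t i ^ ℓ =
      algebraMap K _ ((u i ^ ℓ)⁻¹ * (t (i.val + 1) ^ ℓ - t i.val ^ ℓ)) := by
  rw [dOp, weightedShift_pow, ← weightedShift_zero_eq_algebraMap]
  refine weightedShift_congr (fun m => ?_) (by ext; simp)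
  have h (s : ℕ) : partialChar K hq i.val (m + s • Pi.single i 1) = partialChar K hq i.val m := by
    induction s with
    | zero => simp
    | succ s ih => rw [succ_nsmul, ← add_assoc, partialChar_add_single hq hℓ, ih]; simp
  have h' (s : ℕ) : partialChar K hq (i.val + 1) (m + s • Pi.single i 1) =
      algebraMap ℂ K q ^ s * partialChar K hq (i.val + 1) m := by
    induction s with
    | zero => simp
    | succ s ih =>
      rw [succ_nsmul, ← add_assoc, partialChar_add_single hq hℓ, ih, if_pos (by omega), pow_succ',
        mul_assoc]
  have hQ2 : IsPrimitiveRoot (algebraMap ℂ K q ^ 2) ℓ :=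
    (hq.map_of_injective (algebraMap ℂ K).injective).pow_of_coprime 2
      (Nat.coprime_two_left.2 hodd)
  have hprod := hQ2.prod_pow_succ_mul_sub hodd
    (partialChar K hq (i.val + 1) m ^ 2 * t (i.val + 1)) (partialChar K hq i.val m ^ 2 * t i.val)
  have hp (k : ℕ) : (partialChar K hq k m ^ 2) ^ ℓ = 1 := by
    rw [← pow_mul, mul_comm, pow_mul, partialChar_pow, one_pow]
  rw [mul_pow, mul_pow, hp, hp, one_mul, one_mul] at hprod
  simp only [h, h', Finset.prod_mul_distrib, Finset.prod_const, Finset.card_range, inv_pow,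
    partialChar_pow, inv_one, mul_one]
  rw [← hprod]
  congr 1
  refine Finset.prod_congr rfl fun s _ => ?_
  ring

theorem betaOp_pow (k : ℕ) :
    (betaOp hq t k : Module.End K ((Fin N → ZMod ℓ) → K)) ^ ℓ = algebraMap K _ (t k ^ ℓ) := by
  rw [betaOp, weightedShift_pow, ← weightedShift_zero_eq_algebraMap]
  refine weightedShift_congr (fun m => ?_) (by simp)
  simp only [smul_zero, add_zero, Finset.prod_const, Finset.card_range, mul_pow]
  rw [← pow_mul, mul_comm 2, pow_mul, partialChar_pow, one_pow, one_mul]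

/-- The normalization `t 0 = 1` reflects `β_0 = 1`; the other parameters are free apart from `u i ≠
0`. -/
theorem exists_representation (hq : IsPrimitiveRoot q ℓ) (hu : ∀ i, u i ≠ 0) (hℓ : 1 < ℓ) (hodd : Odd ℓ) (ht : t 0 = 1) :
    ∃ ρ : Dq q N →ₐ[ℂ] Module.End K ((Fin N → ZMod ℓ) → K),
      (∀ i, ρ (x q N i) ^ ℓ = algebraMap K _ (u i ^ ℓ)) ∧
      (∀ i, ρ (d q N i) ^ ℓ =
        algebraMap K _ ((u i ^ ℓ)⁻¹ * (t (i.val + 1) ^ ℓ - t i.val ^ ℓ))) ∧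
      ∀ k ≤ N, ρ (beta q N k) ^ ℓ = algebraMap K _ (t k ^ ℓ) := by
  let φ : FreeAlgebra ℂ (Fin N ⊕ Fin N) →ₐ[ℂ] Module.End K ((Fin N → ZMod ℓ) → K) :=
    FreeAlgebra.lift ℂ (Sum.elim (xOp hq u) (dOp hq u t))
  have hφx (i : Fin N) : φ (freeX N i) = xOp hq u i := by simp [φ]
  have hφd (i : Fin N) : φ (freeD N i) = dOp hq u t i := by simp [φ]
  have hbeta (k : ℕ) (hk : k ≤ N) :
      1 + ∑ j : Fin N with j.val < k, xOp hq u j * dOp hq u t j = betaOp hq t k := by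
    induction k with
    | zero =>
      simp only [betaOp, partialChar_zero, ht]
      rw [weightedShift_zero_eq_algebraMap]
      simp
    | succ k ih =>
      have e : (Finset.univ.filter fun j : Fin N => j.val < k + 1) =
          insert ⟨k, hk⟩ (Finset.univ.filter fun j : Fin N => j.val < k) := by
        ext j; simp [Fin.ext_iff]; omega
      rw [e, Finset.sum_insert (by simp), add_left_comm, ih (by omega), add_comm]
      exact betaOp_add_xOp_mul_dOp hq t hu hℓ ⟨k, hk⟩
  have hrel ⦃a b⦄ (h : Rel q N a b) : φ a = φ b := by
    induction h with
    | xx i j h => simpa only [map_mul, map_smul, hφx] using xOp_mul_xOp hq hℓ i j h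
    | dd i j h => simpa only [map_mul, map_smul, hφd] using dOp_mul_dOp hq t hu hℓ i j h
    | dx i j h =>
      simpa only [map_mul, map_smul, hφd, hφx] using dOp_mul_xOp hq t hu hℓ i j h
    | dx_self i =>
      have e : Finset.Iio i = (Finset.univ.filter fun j : Fin N => j.val < i.val) := by
        ext j; simp
      simp only [map_mul, map_smul, map_add, map_one, map_sum, hφd, hφx]
      rw [e, hbeta _ i.2.le]
      exact dOp_mul_xOp_self hq t hu hℓ i
  let ρ : Dq q N →ₐ[ℂ] Module.End K ((Fin N → ZMod ℓ) → K) :=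
    RingQuot.liftAlgHom ℂ ⟨φ, hrel⟩
  have hmk (a) : ρ (mk q N a) = φ a := RingQuot.liftAlgHom_mkAlgHom_apply ℂ φ hrel a
  have hρx (i : Fin N) : ρ (x q N i) = xOp hq u i := (hmk _).trans (hφx i)
  have hρd (i : Fin N) : ρ (d q N i) = dOp hq u t i := (hmk _).trans (hφd i)
  refine ⟨ρ, fun i => ?_, fun i => ?_, fun k hk => ?_⟩
  · rw [hρx, xOp_pow hq hℓ]
  · rw [hρd, dOp_pow hq t hℓ hodd]
  · rw [beta]
    simp only [map_add, map_one, map_sum, map_mul, hρx, hρd]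
    rw [hbeta k hk, betaOp_pow hq t]

end Representation

end QDiff

namespace QDiff

variable {q : ℂ} {N ℓ : ℕ}

/-! ## The restricted monomials form a basis over the centre -/

section Faithful

variable {K E : Type} [Field K] [Algebra ℂ K] [Ring E] [Algebra K E]
  [Algebra ℂ E] {f : MvPolynomial (Fin N ⊕ Fin N) ℂ →ₐ[ℂ] K} {ρ : Dq q N →ₐ[ℂ] E}

theorem map_powHom_smul (hℓ : 0 < ℓ) (hq : IsPrimitiveRoot q ℓ)
    (hρ : ∀ p, ρ (powHom N hℓ hq p : Dq q N) = algebraMap K E (f p))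
    (p : MvPolynomial (Fin N ⊕ Fin N) ℂ) (y : Dq q N) :
    ρ (powHom N hℓ hq p • y) = f p • ρ y := by
  rw [Algebra.smul_def, map_mul, Algebra.smul_def, ← hρ]
  rfl

theorem injective_of_linearIndependent (hℓ : 0 < ℓ) (hq : IsPrimitiveRoot q ℓ)
    (hf : Function.Injective f)
    (hρ : ∀ p, ρ (powHom N hℓ hq p : Dq q N) = algebraMap K E (f p))
    (hlin : LinearIndependent K (ρ ∘ restrictedMonomial q N ℓ)) : Function.Injective ρ := by
  rw [injective_iff_map_eq_zero]
  intro y hy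
  obtain ⟨p, rfl⟩ := exists_eq_sum_powHom_smul hℓ hq y
  rw [map_sum] at hy
  simp only [map_powHom_smul _ hq hρ] at hy
  have hp := Fintype.linearIndependent_iff.1 hlin _ hy
  refine Finset.sum_eq_zero fun a _ => ?_
  rw [(map_eq_zero_iff f hf).1 (hp a), map_zero, zero_smul]

variable [IsAlgClosed K]

theorem span_map_restrictedMonomial_eq_top [IsScalarTower ℂ K E] [FiniteDimensional K E]
    [Nontrivial E] (hℓ : 1 < ℓ) (hodd : Odd ℓ) (hq : IsPrimitiveRoot q ℓ)
    (hρ : ∀ p, ρ (powHom N (zero_lt_one.trans hℓ) hq p : Dq q N) = algebraMap K E (f p))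
    (hβ : ∀ k, ∃ c : K, c ≠ 0 ∧ ρ (beta q N k) ^ ℓ = algebraMap K E c)
    (hE : Module.finrank K E = ℓ ^ N * ℓ ^ N) :
    Submodule.span K (Set.range (ρ ∘ restrictedMonomial q N ℓ)) = ⊤ := by
  have hmem (y : Dq q N) :
      ρ y ∈ Submodule.span K (Set.range (ρ ∘ restrictedMonomial q N ℓ)) := by
    obtain ⟨p, rfl⟩ := exists_eq_sum_powHom_smul (zero_lt_one.trans hℓ) hq y
    rw [map_sum]
    refine Submodule.sum_mem _ fun a _ => ?_
    rw [map_powHom_smul _ hq hρ]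
    exact Submodule.smul_mem _ _ (Submodule.subset_span ⟨a, rfl⟩)
  -- The matrix criterion applied to the subalgebra generated by the image forces its dimension up
  -- to that of `E`, so irreducibility need not be checked by hand.
  let F : Subalgebra K E := Algebra.adjoin K (Set.range ρ)
  let ψ : Dq q N →ₐ[ℂ] F :=
    { toFun := fun y => ⟨ρ y, Algebra.subset_adjoin ⟨y, rfl⟩⟩
      map_one' := Subtype.ext (map_one ρ)
      map_mul' := fun y y' => Subtype.ext (map_mul ρ y y')
      map_zero' := Subtype.ext (map_zero ρ)
      map_add' := fun y y' => Subtype.ext (map_add ρ y y')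
      commutes' := fun c => Subtype.ext (ρ.commutes c) }
  have hψ (k : ℕ) : ∃ c : K, c ≠ 0 ∧ ψ (beta q N k) ^ ℓ = algebraMap K F c := by
    obtain ⟨c, hc, h⟩ := hβ k
    exact ⟨c, hc, Subtype.ext h⟩
  have hFle : Module.finrank K F ≤ ℓ ^ N * ℓ ^ N :=
    hE ▸ Submodule.finrank_le (Subalgebra.toSubmodule F)
  obtain ⟨e⟩ := nonempty_algEquiv_matrix (K := K) (F := F) hℓ hodd hq ψ hψ hFle
  have hFtop : Subalgebra.toSubmodule F = ⊤ := by
    refine Submodule.eq_top_of_finrank_eq ?_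
    rw [hE]
    have := e.toLinearEquiv.finrank_eq
    rw [Module.finrank_matrix] at this
    simpa using this
  rw [eq_top_iff, ← hFtop, Algebra.adjoin_eq_span, Submodule.span_le]
  have : Submonoid.closure (Set.range ρ) ≤ MonoidHom.mrange (ρ : Dq q N →* E) :=
    Submonoid.closure_le.2 (by rintro _ ⟨y, rfl⟩; exact ⟨y, rfl⟩)
  intro y hy
  obtain ⟨y, rfl⟩ := this hy
  exact hmem y

variable (f) in
theorem exists_generic_representation (hℓ : 1 < ℓ) (hodd : Odd ℓ) (hq : IsPrimitiveRoot q ℓ)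
    (hf : Function.Injective f) [NeZero ℓ] :
    ∃ ρ : Dq q N →ₐ[ℂ] Module.End K ((Fin N → ZMod ℓ) → K),
      (∀ p, ρ (powHom N (zero_lt_one.trans hℓ) hq p : Dq q N) = algebraMap K _ (f p)) ∧
      ∀ k, ∃ c : K, c ≠ 0 ∧ ρ (beta q N k) ^ ℓ = algebraMap K _ c := by
  have hpos : 0 < ℓ := zero_lt_one.trans hℓ
  -- `T k` is the intended value of `β_k ^ ℓ`: then `(T (i + 1) - T i) / X_i` is the variable
  -- prescribed for `∂_i ^ ℓ`.
  let T (k : ℕ) : MvPolynomial (Fin N ⊕ Fin N) ℂ :=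
    1 + ∑ j : Fin N with j.val < k, MvPolynomial.X (Sum.inl j) * MvPolynomial.X (Sum.inr j)
  have hT0 (k : ℕ) : f (T k) ≠ 0 := by
    rw [Ne, map_eq_zero_iff f hf]
    intro h
    have := congrArg (MvPolynomial.eval (fun _ => (0 : ℂ))) h
    simp [T] at this
  have hTsucc (i : Fin N) :
      T (i + 1) - T i = MvPolynomial.X (Sum.inl i) * MvPolynomial.X (Sum.inr i) := by
    have e : (Finset.univ.filter fun j : Fin N => j.val < i.val + 1) =
        insert i (Finset.univ.filter fun j : Fin N => j.val < i.val) := by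
      ext j; simp [Fin.ext_iff]; omega
    simp only [T]
    rw [e, Finset.sum_insert (by simp)]
    ring
  choose u hu using fun i : Fin N =>
    IsAlgClosed.exists_pow_nat_eq (f (MvPolynomial.X (Sum.inl i))) hpos
  obtain ⟨t, ht0, ht⟩ : ∃ t : ℕ → K, t 0 = 1 ∧ ∀ k, t k ^ ℓ = f (T k) := by
    choose t ht using fun k => IsAlgClosed.exists_pow_nat_eq (f (T k)) hpos
    -- Since `T 0 = 1`, the chosen root at 0 may be replaced by 1.
    refine ⟨Function.update t 0 1, by simp, fun k => ?_⟩
    rcases eq_or_ne k 0 with rfl | hk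
    · simp [T]
    · simp [hk, ht]
  have hX (i : Fin N) : f (MvPolynomial.X (Sum.inl i)) ≠ 0 := by
    rw [Ne, map_eq_zero_iff f hf]; exact MvPolynomial.X_ne_zero _
  have hu0 (i : Fin N) : u i ≠ 0 := fun h => hX i (by rw [← hu, h, zero_pow hpos.ne'])
  obtain ⟨ρ, hρx, hρd, hρβ⟩ := exists_representation (K := K) (t := t) hq hu0 hℓ hodd ht0
  refine ⟨ρ, fun p => ?_, fun k => ?_⟩
  · have : (ρ.comp (Subalgebra.val _)).comp (powHom N hpos hq) =
        ((Algebra.ofId K _).restrictScalars ℂ).comp f := by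
      refine MvPolynomial.algHom_ext fun i => ?_
      rcases i with i | i
      · simp [powHom, hρx, hu, Algebra.ofId_apply]
      · have h1 : (u i ^ ℓ)⁻¹ * (t (i.val + 1) ^ ℓ - t i.val ^ ℓ) =
            f (MvPolynomial.X (Sum.inr i)) := by
          rw [ht, ht, hu, ← map_sub, hTsucc, map_mul, inv_mul_cancel_left₀ (hX i)]
        have h2 := hρd i
        rw [h1] at h2
        simp [powHom, h2, Algebra.ofId_apply]
    exact DFunLike.congr_fun this p
  · rcases le_total k N with hk | hk
    · exact ⟨_, hT0 k, by rw [← ht, hρβ k hk]⟩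
    · exact ⟨_, hT0 N, by rw [← ht, beta_eq_of_le k hk, hρβ N le_rfl]⟩

end Faithful

theorem exists_faithful_representation (hℓ : 1 < ℓ) (hodd : Odd ℓ) (hq : IsPrimitiveRoot q ℓ)
    {K : Type} [Field K] [IsAlgClosed K] [Algebra ℂ K]
    (f : MvPolynomial (Fin N ⊕ Fin N) ℂ →ₐ[ℂ] K) (hf : Function.Injective f) :
    ∃ (E : Type) (_ : Ring E) (_ : Algebra K E) (_ : Algebra ℂ E) (ρ : Dq q N →ₐ[ℂ] E),
      Algebra.IsCentral K E ∧ Function.Injective ρ ∧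
      LinearIndependent K (ρ ∘ restrictedMonomial q N ℓ) ∧
      Submodule.span K (Set.range (ρ ∘ restrictedMonomial q N ℓ)) = ⊤ := by
  have : NeZero ℓ := ⟨by omega⟩
  obtain ⟨ρ, hρ, hβ⟩ := exists_generic_representation f hℓ hodd hq hf
  have hE : Module.finrank K (Module.End K ((Fin N → ZMod ℓ) → K)) = ℓ ^ N * ℓ ^ N := by
    rw [Module.finrank_linearMap]
    simp
  have hspan := span_map_restrictedMonomial_eq_top hℓ hodd hq hρ hβ hE
  have hlin : LinearIndependent K (ρ ∘ restrictedMonomial q N ℓ) :=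
    linearIndependent_of_top_le_span_of_card_eq_finrank hspan.ge (by rw [hE]; simp)
  exact ⟨_, _, _, _, ρ, inferInstance, injective_of_linearIndependent _ hq hf hρ hlin, hlin, hspan⟩

theorem linearIndependent_restrictedMonomial (hℓ : 1 < ℓ) (hodd : Odd ℓ)
    (hq : IsPrimitiveRoot q ℓ) : LinearIndependent (Zc q N) (restrictedMonomial q N ℓ) := by
  let K := AlgebraicClosure (FractionRing (MvPolynomial (Fin N ⊕ Fin N) ℂ))
  let f : MvPolynomial (Fin N ⊕ Fin N) ℂ →ₐ[ℂ] K := IsScalarTower.toAlgHom ℂ _ K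
  have hf : Function.Injective f := by
    change Function.Injective (algebraMap (MvPolynomial (Fin N ⊕ Fin N) ℂ) K)
    rw [IsScalarTower.algebraMap_eq _ (FractionRing (MvPolynomial (Fin N ⊕ Fin N) ℂ)) K]
    exact (FaithfulSMul.algebraMap_injective (FractionRing (MvPolynomial (Fin N ⊕ Fin N) ℂ)) K).comp
      (IsFractionRing.injective _ _)
  obtain ⟨E, _, _, _, ρ, hE, hinj, hlin, hspan⟩ :=
    exists_faithful_representation hℓ hodd hq f hf
  rw [Fintype.linearIndependent_iff]
  intro z hz a
  -- The image of a central element commutes with a `K`-spanning set of the central algebra `E`, so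
  -- it is a scalar. A relation over the centre thus becomes one over `K`.
  have hcentral (c : Zc q N) : ∃ k : K, ρ c = algebraMap K E k := by
    have : ρ c ∈ Subalgebra.center K E := by
      rw [Subalgebra.mem_center_iff]
      intro y
      have hy : y ∈ Submodule.span K (Set.range (ρ ∘ restrictedMonomial q N ℓ)) :=
        hspan ▸ Submodule.mem_top
      induction hy using Submodule.span_induction with
      | mem y hy =>
        obtain ⟨a, rfl⟩ := hy
        simp only [Function.comp_apply]
        rw [← map_mul, ← map_mul, Subalgebra.mem_center_iff.1 c.2]
      | zero => simp
      | add y y' _ _ h h' => rw [add_mul, mul_add, h, h']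
      | smul k y _ h => rw [smul_mul_assoc, mul_smul_comm, h]
    obtain ⟨k, hk⟩ := Algebra.mem_bot.1 (hE.out this)
    exact ⟨k, hk.symm⟩
  choose k hk using fun a => hcentral (z a)
  have h := congrArg ρ hz
  rw [map_sum, map_zero] at h
  have hsm (a) : ρ (z a • restrictedMonomial q N ℓ a) =
      k a • (ρ ∘ restrictedMonomial q N ℓ) a := by
    rw [Algebra.smul_def, map_mul, Algebra.smul_def, ← hk]
    rfl
  simp only [hsm] at h
  have hka := Fintype.linearIndependent_iff.1 hlin _ h a
  have h0 : ρ (z a : Dq q N) = 0 := by rw [hk, hka, map_zero]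
  exact Subtype.ext ((map_eq_zero_iff ρ hinj).1 h0)

/-- The restricted monomials as a basis of `D_q(ℂ^N)` over its centre. -/
def restrictedBasis (N : ℕ) (hℓ : 1 < ℓ) (hodd : Odd ℓ) (hq : IsPrimitiveRoot q ℓ) :
    Module.Basis ((Fin N → Fin ℓ) × (Fin N → Fin ℓ)) (Zc q N) (Dq q N) :=
  Module.Basis.mk (linearIndependent_restrictedMonomial hℓ hodd hq) fun y _ => by
    obtain ⟨p, rfl⟩ := exists_eq_sum_powHom_smul (by omega : 0 < ℓ) hq y
    exact Submodule.sum_mem _ fun a _ =>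
      Submodule.smul_mem _ _ (Submodule.subset_span ⟨a, rfl⟩)

theorem restrictedBasis_apply (hℓ : 1 < ℓ) (hodd : Odd ℓ) (hq : IsPrimitiveRoot q ℓ)
    (a : (Fin N → Fin ℓ) × (Fin N → Fin ℓ)) :
    restrictedBasis N hℓ hodd hq a = restrictedMonomial q N ℓ a :=
  Module.Basis.mk_apply _ _ _

theorem restrictedMonomial_zero [NeZero ℓ] : restrictedMonomial q N ℓ 0 = 1 := by
  have : (fun i : Fin N => (((0 : Fin N → Fin ℓ) i : Fin ℓ) : ℕ)) = 0 := by funext; simp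
  simp only [restrictedMonomial, Prod.fst_zero, Prod.snd_zero, this, orderedMonomial_zero, mul_one]

/-- A central `z` is `z • 1`, while the spanning result expands it with polynomial coefficients;
comparing coordinates at the basis element 1 gives `z`. -/
theorem powHom_surjective (hℓ : 1 < ℓ) (hodd : Odd ℓ) (hq : IsPrimitiveRoot q ℓ) :
    Function.Surjective (powHom N (by omega : 0 < ℓ) hq) := by
  have : NeZero ℓ := ⟨by omega⟩
  intro z
  obtain ⟨p, hp⟩ := exists_eq_sum_powHom_smul (by omega : 0 < ℓ) hq (z : Dq q N)
  refine ⟨p 0, ?_⟩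
  have h1 : (z : Dq q N) = z • restrictedBasis N hℓ hodd hq 0 := by
    rw [restrictedBasis_apply, restrictedMonomial_zero, Algebra.smul_def, mul_one]; rfl
  simp only [← restrictedBasis_apply hℓ hodd hq] at hp
  have h2 := congrArg (fun y => (restrictedBasis N hℓ hodd hq).repr y 0) (hp.symm.trans h1)
  simpa [Module.Basis.repr_sum_self, Finsupp.single_apply] using h2

theorem finiteType_center (hℓ : 1 < ℓ) (hodd : Odd ℓ) (hq : IsPrimitiveRoot q ℓ) :
    Algebra.FiniteType ℂ (Zc q N) :=
  Algebra.FiniteType.of_surjective _ (powHom_surjective hℓ hodd hq)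

/-- As `ℓ > 1`, each `x_i ∂_i` is a scalar times a basis monomial other than 1. This shows that
`β_k` is nonzero in every fibre. -/
theorem restrictedBasis_repr_beta [NeZero ℓ] (hℓ : 1 < ℓ) (hodd : Odd ℓ)
    (hq : IsPrimitiveRoot q ℓ) (k : ℕ) :
    (restrictedBasis N hℓ hodd hq).repr (beta q N k) 0 = 1 := by
  have hq0 := hq.ne_zero (NeZero.ne ℓ)
  have hone : (restrictedBasis N hℓ hodd hq).repr 1 0 = 1 := by
    rw [← restrictedMonomial_zero (ℓ := ℓ), ← restrictedBasis_apply hℓ hodd hq,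
      Module.Basis.repr_self, Finsupp.single_eq_same]
  have hxd (i : Fin N) : (restrictedBasis N hℓ hodd hq).repr (x q N i * d q N i) 0 = 0 := by
    obtain ⟨c, hc⟩ := exists_x_mul_orderedMonomial (N := N) hq0 i 0
    obtain ⟨c', hc'⟩ := exists_d_mul_orderedMonomial (N := N) hq0 i 0
    rw [orderedMonomial_zero, mul_one, zero_add] at hc hc'
    let s : Fin N → Fin ℓ := Pi.single i ⟨1, hℓ⟩
    have hs : (fun j => (s j : ℕ)) = Pi.single i 1 := by
      funext j
      by_cases hj : j = i
      · subst hj; simp [s]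
      · simp [s, hj]
    have h : x q N i * d q N i = algebraMap ℂ (Zc q N) (c * c') •
        restrictedBasis N hℓ hodd hq (s, s) := by
      rw [restrictedBasis_apply, restrictedMonomial, hs, algebraMap_smul, hc, hc',
        smul_mul_smul_comm]
    have hne : (s, s) ≠ 0 := by
      intro h0
      have := congrArg Fin.val (congrFun (congrArg Prod.fst h0) i)
      simp [s] at this
    rw [h, map_smul, Module.Basis.repr_self, Finsupp.smul_apply, Finsupp.single_eq_of_ne' hne,
      smul_zero]
  rw [beta, map_add, map_sum, Finsupp.add_apply, Finsupp.finsetSum_apply, hone]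
  simp only [hxd, Finset.sum_const_zero, add_zero]

end QDiff

/-! ## Azumaya algebras and fibres -/

section Fibers

variable {R A : Type} [CommRing R] [Ring A] [Algebra R A]

/-- Nullstellensatz. -/
theorem bijective_algebraMap_residue [Algebra ℂ R] [Algebra.FiniteType ℂ R]
    (m : MaximalSpectrum R) : Function.Bijective (algebraMap ℂ (R ⧸ m.asIdeal)) := by
  have := m.isMaximal
  let := Ideal.Quotient.field m.asIdeal
  have : Module.Finite ℂ (R ⧸ m.asIdeal) := finite_of_finite_type_of_isJacobsonRing ℂ _
  exact IsAlgClosed.algebraMap_bijective_of_isIntegral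

theorem exists_one_tmul_eq (I : Ideal R) (y : (R ⧸ I) ⊗[R] A) :
    ∃ a : A, (1 : R ⧸ I) ⊗ₜ[R] a = y := by
  induction y using TensorProduct.induction_on with
  | zero => exact ⟨0, TensorProduct.tmul_zero _ _⟩
  | tmul c a =>
    obtain ⟨r, rfl⟩ := Ideal.Quotient.mk_surjective c
    refine ⟨r • a, ?_⟩
    rw [← TensorProduct.smul_tmul, Algebra.smul_def, mul_one]
    rfl
  | add y y' h h' =>
    obtain ⟨a, rfl⟩ := h
    obtain ⟨a', rfl⟩ := h'
    exact ⟨a + a', TensorProduct.tmul_add _ _ _⟩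

variable {ι : Type} (b : Module.Basis ι R A)

include b in
theorem repr_mem_of_one_tmul_eq_zero (I : Ideal R) {a : A}
    (h : (1 : R ⧸ I) ⊗ₜ[R] a = 0) (i : ι) : b.repr a i ∈ I := by
  have h1 := congrArg (fun y => (b.baseChange (R ⧸ I)).repr y i) h
  simp only [Module.Basis.baseChange_repr_tmul, map_zero, Finsupp.zero_apply] at h1
  rw [Algebra.smul_def, mul_one] at h1
  exact Ideal.Quotient.eq_zero_iff_mem.1 h1

/-- Nakayama for `M ⧸ P`, at a maximal ideal containing its annihilator. -/
theorem Submodule.eq_top_of_forall_le_sup_smul {M : Type} [AddCommGroup M] [Module R M]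
    [Module.Finite R M] (P : Submodule R M)
    (h : ∀ m : Ideal R, m.IsMaximal → ⊤ ≤ P ⊔ m • (⊤ : Submodule R M)) : P = ⊤ := by
  by_contra hP
  have hann : Module.annihilator R (M ⧸ P) ≠ ⊤ := by
    intro h1
    rw [Module.annihilator_eq_top_iff] at h1
    exact hP (Submodule.Quotient.subsingleton_iff.1 h1)
  obtain ⟨m, hm, hle⟩ := Ideal.exists_le_maximal _ hann
  have htop : (⊤ : Submodule R (M ⧸ P)) ≤ m • ⊤ := by
    have h2 := Submodule.map_mono (f := P.mkQ) (h m hm)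
    rwa [Submodule.map_sup, Submodule.map_smul'', Submodule.map_top, Submodule.range_mkQ,
      Submodule.mkQ_map_self, bot_sup_eq] at h2
  obtain ⟨r, hr, hr0⟩ := Submodule.exists_sub_one_mem_and_smul_eq_zero_of_fg_of_le_smul m
    (⊤ : Submodule R (M ⧸ P)) Module.Finite.fg_top htop
  have hrm : r ∈ m := hle (Module.mem_annihilator.2 fun y => hr0 y Submodule.mem_top)
  exact hm.ne_top ((Ideal.eq_top_iff_one m).2 (by simpa using m.sub_mem hrm hr))

include b in
/-- A free algebra of finite rank whose fibres at the maximal ideals are matrix algebras over `ℂ`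
is an Azumaya algebra. -/
theorem isAzumaya_of_fiberIsMatrix [Algebra ℂ R] [Finite ι] [Nonempty ι]
    (h : ∀ m : MaximalSpectrum R, ∃ n, 0 < n ∧ AzumayaLocus.FiberIsMatrix R A m n) :
    IsAzumaya R A := by
  classical
  have := Fintype.ofFinite ι
  have : Module.Free R A := .of_basis b
  have : Module.Finite R A := .of_basis b
  have hsurj : Function.Surjective (AlgHom.mulLeftRight R A).toLinearMap := by
    rw [← LinearMap.range_eq_top]
    refine Submodule.eq_top_of_forall_le_sup_smul _ fun m hm f _ => ?_
    obtain ⟨n, hn, ⟨e⟩⟩ := h ⟨m, hm⟩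
    have : Nonempty (Fin n) := ⟨⟨0, hn⟩⟩
    have := IsAzumaya.matrix ℂ (Fin n)
    have hAz : IsAzumaya ℂ ((R ⧸ m) ⊗[R] A) := IsAzumaya.of_AlgEquiv ℂ _ _ e.symm
    obtain ⟨t, ht⟩ := hAz.bij.2 ((f.baseChange (R ⧸ m)).restrictScalars ℂ)
    -- Two-sided multiplications of the fibre lift to `A`, because `A` surjects onto the fibre. Thus
    -- `f` agrees modulo `m` with a two-sided multiplication of `A`.
    have hlift (t : ((R ⧸ m) ⊗[R] A) ⊗[ℂ] ((R ⧸ m) ⊗[R] A)ᵐᵒᵖ) :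
        ∃ s : A ⊗[R] Aᵐᵒᵖ, ∀ y : A, AlgHom.mulLeftRight ℂ _ t ((1 : R ⧸ m) ⊗ₜ[R] y) =
          (1 : R ⧸ m) ⊗ₜ[R] AlgHom.mulLeftRight R A s y := by
      induction t using TensorProduct.induction_on with
      | zero => exact ⟨0, fun y => by simp⟩
      | tmul a c =>
        obtain ⟨a, rfl⟩ := exists_one_tmul_eq m a
        obtain ⟨c', hc⟩ := exists_one_tmul_eq m c.unop
        refine ⟨a ⊗ₜ MulOpposite.op c', fun y => ?_⟩
        rw [AlgHom.mulLeftRight_apply, AlgHom.mulLeftRight_apply, ← hc]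
        simp
      | add t t' h h' =>
        obtain ⟨s, hs⟩ := h
        obtain ⟨s', hs'⟩ := h'
        exact ⟨s + s', fun y => by simp [hs, hs', TensorProduct.tmul_add]⟩
    obtain ⟨s, hs⟩ := hlift t
    set g := f - AlgHom.mulLeftRight R A s with hg
    have hg0 (y : A) : (1 : R ⧸ m) ⊗ₜ[R] g y = 0 := by
      rw [hg, LinearMap.sub_apply, TensorProduct.tmul_sub, ← hs, ht]
      simp
    have hgm : g ∈ m • (⊤ : Submodule R (Module.End R A)) := by
      have e : g = ∑ i, ∑ j, b.repr (g (b i)) j • (b.coord i).smulRight (b j) := by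
        refine b.ext fun i => ?_
        simp [LinearMap.sum_apply, Finsupp.single_apply, b.sum_repr]
      rw [e]
      exact Submodule.sum_mem _ fun i _ => Submodule.sum_mem _ fun j _ =>
        Submodule.smul_mem_smul (repr_mem_of_one_tmul_eq_zero b m (hg0 _) j) Submodule.mem_top
    rw [← sub_add_cancel f (AlgHom.mulLeftRight R A s), add_comm]
    exact Submodule.add_mem_sup ⟨s, rfl⟩ hgm
  let b₁ := b.tensorProduct (b.map (MulOpposite.opLinearEquiv R))
  let b₂ := (Matrix.stdBasis R ι ι).map (LinearMap.toMatrix b b).symm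
  -- Source and target are free of the same finite rank, so surjectivity gives injectivity.
  have hinj := OrzechProperty.injective_of_surjective_of_injective
    (b₁.equiv b₂ (Equiv.refl _)).toLinearMap _ (b₁.equiv b₂ (Equiv.refl _)).injective hsurj
  exact
    { toProjective := inferInstance
      eq_of_smul_eq_smul := fun {r s} hrs => by
        obtain ⟨i⟩ := ‹Nonempty ι›
        simpa using congrArg (fun y => b.repr y i) (hrs (b i))
      toFinite := inferInstance
      bij := ⟨hinj, hsurj⟩ }

theorem isAzumayaOver_of_isAzumaya [Algebra ℂ R] [Module.Free R A] (h : IsAzumaya R A)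
    (hlocus : AzumayaLocus.azumayaLocus R A = Set.univ) : AzumayaLocus.IsAzumayaOver R A where
  injective := FaithfulSMul.algebraMap_injective R A
  range_eq_center := by
    have h := Algebra.IsCentral.center_eq_bot R A
    rw [← Algebra.coe_bot, ← h]
    rfl
  finite := inferInstance
  projective := inferInstance
  locus_eq_univ := hlocus

end Fibers

namespace QDiff

variable {q : ℂ} {N ℓ : ℕ}

/-- A fibre of a free algebra of rank `ℓ ^ (2 * N)` over an algebra of finite type is a matrix
algebra where the `β_k ^ ℓ` do not vanish. -/
theorem fiberIsMatrix_of_not_mem {R A : Type} [CommRing R] [Ring A] [Algebra R A] [Algebra ℂ R]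
    [Algebra ℂ A] [IsScalarTower ℂ R A] [Algebra.FiniteType ℂ R] {ι : Type} [Fintype ι]
    (b : Module.Basis ι R A) (hcard : Fintype.card ι = ℓ ^ N * ℓ ^ N)
    (hℓ : 1 < ℓ) (hodd : Odd ℓ) (hq : IsPrimitiveRoot q ℓ) (ψ : Dq q N →ₐ[ℂ] A) (r : ℕ → R)
    (hr : ∀ k, ψ (beta q N k) ^ ℓ = algebraMap R A (r k)) (m : MaximalSpectrum R)
    (hrm : ∀ k, r k ∉ m.asIdeal) : AzumayaLocus.FiberIsMatrix R A m (ℓ ^ N) := by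
  have := m.isMaximal
  let := Ideal.Quotient.field m.asIdeal
  have hbij := bijective_algebraMap_residue m
  let F := (R ⧸ m.asIdeal) ⊗[R] A
  let incl : A →ₐ[ℂ] F := (Algebra.TensorProduct.includeRight : A →ₐ[R] F).restrictScalars ℂ
  let bF : Module.Basis ι (R ⧸ m.asIdeal) F := b.baseChange _
  have hfin1 : Module.finrank ℂ (R ⧸ m.asIdeal) = 1 := by
    rw [← (LinearEquiv.ofBijective (Algebra.linearMap ℂ (R ⧸ m.asIdeal)) hbij).finrank_eq,
      Module.finrank_self]
  have : Module.Finite ℂ (R ⧸ m.asIdeal) := Module.finite_of_finrank_pos (by omega)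
  have : Module.Finite (R ⧸ m.asIdeal) F := .of_basis bF
  have : Module.Finite ℂ F := Module.Finite.trans (R ⧸ m.asIdeal) F
  have hfin : Module.finrank ℂ F = ℓ ^ N * ℓ ^ N := by
    rw [← Module.finrank_mul_finrank ℂ (R ⧸ m.asIdeal) F, hfin1, one_mul,
      Module.finrank_eq_card_basis bF, hcard]
  have : Nontrivial F := Module.nontrivial_of_finrank_pos (R := ℂ) (by
    rw [hfin]; positivity)
  refine nonempty_algEquiv_matrix (K := ℂ) (F := F) hℓ hodd hq (incl.comp ψ) (fun k => ?_) hfin.le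
  obtain ⟨c, hc⟩ := hbij.2 (Ideal.Quotient.mk m.asIdeal (r k))
  refine ⟨c, ?_, ?_⟩
  · rintro rfl
    rw [map_zero] at hc
    exact hrm k (Ideal.Quotient.eq_zero_iff_mem.1 hc.symm)
  · rw [AlgHom.comp_apply, ← map_pow, hr]
    have h1 : incl (algebraMap R A (r k)) = algebraMap R F (r k) :=
      (Algebra.TensorProduct.includeRight : A →ₐ[R] F).commutes (r k)
    rw [h1, IsScalarTower.algebraMap_apply ℂ (R ⧸ m.asIdeal) F, hc,
      IsScalarTower.algebraMap_apply R (R ⧸ m.asIdeal) F]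
    rfl

end QDiff

namespace QDiff

variable {q : ℂ} {N ℓ : ℕ}

/-! ## The Azumaya locus -/

theorem betaPow_of_le (hq : IsPrimitiveRoot q ℓ) (k : ℕ) :
    ∃ j : Fin (N + 1), betaPow N hq k = betaPow N hq j.val := by
  rcases le_total k N with hk | hk
  · exact ⟨⟨k, by omega⟩, rfl⟩
  · exact ⟨⟨N, by omega⟩, Subtype.ext (by simp only [betaPow, beta_eq_of_le k hk])⟩

theorem fiberIsMatrix_center (hℓ : 1 < ℓ) (hodd : Odd ℓ) (hq : IsPrimitiveRoot q ℓ)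
    (m : MaximalSpectrum (Zc q N)) (hm : ∀ k : Fin (N + 1), betaPow N hq k.val ∉ m.asIdeal) :
    AzumayaLocus.FiberIsMatrix (Zc q N) (Dq q N) m (ℓ ^ N) := by
  have := finiteType_center (N := N) hℓ hodd hq
  refine fiberIsMatrix_of_not_mem (restrictedBasis N hℓ hodd hq) (by simp) hℓ hodd hq
    (AlgHom.id ℂ _) (betaPow N hq) (fun k => rfl) m fun k => ?_
  obtain ⟨j, hj⟩ := betaPow_of_le (N := N) hq k
  rw [hj]
  exact hm j

/-- Generators pass `β_k` up to nonzero scalars. This normality makes `β_k` generate a nilpotent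
ideal in a fibre where `β_k ^ ℓ` vanishes. -/
theorem exists_beta_mul_eq (hq : q ≠ 0) (k : ℕ) (y : Dq q N) :
    ∃ y', beta q N k * y = y' * beta q N k := by
  obtain ⟨w, rfl⟩ := mk_surjective q N y
  induction w using FreeAlgebra.induction with
  | grade0 r => exact ⟨_, by rw [AlgHom.commutes]; exact (Algebra.commutes r _).symm⟩
  | grade1 s =>
    rcases s with i | i
    · refine ⟨(if i.val < k then q ^ 2 else 1) • x q N i, ?_⟩
      rw [smul_mul_assoc]
      exact beta_mul_x q N k i
    · refine ⟨(if i.val < k then q ^ 2 else 1)⁻¹ • d q N i, ?_⟩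
      rw [smul_mul_assoc, d_mul_beta q N hq, smul_smul, inv_mul_cancel₀, one_smul]
      · rfl
      · split_ifs
        · exact pow_ne_zero _ hq
        · exact one_ne_zero
  | mul a b ha hb =>
    obtain ⟨a', ha⟩ := ha
    obtain ⟨b', hb⟩ := hb
    exact ⟨a' * b', by rw [map_mul, ← mul_assoc, ha, mul_assoc, hb, mul_assoc]⟩
  | add a b ha hb =>
    obtain ⟨a', ha⟩ := ha
    obtain ⟨b', hb⟩ := hb
    exact ⟨a' + b', by rw [map_add, mul_add, ha, hb, add_mul]⟩

theorem betaPow_not_mem_of_fiberIsMatrix (hℓ : 1 < ℓ) (hodd : Odd ℓ) (hq : IsPrimitiveRoot q ℓ)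
    {m : MaximalSpectrum (Zc q N)} {n : ℕ}
    (h : AzumayaLocus.FiberIsMatrix (Zc q N) (Dq q N) m n) (k : ℕ) :
    betaPow N hq k ∉ m.asIdeal := by
  intro hk
  have : NeZero ℓ := ⟨by omega⟩
  obtain ⟨e⟩ := h
  let incl : Dq q N →ₐ[Zc q N] (Zc q N ⧸ m.asIdeal) ⊗[Zc q N] Dq q N :=
    Algebra.TensorProduct.includeRight
  have hpow : incl (beta q N k) ^ ℓ = 0 := by
    have h1 : incl (algebraMap _ _ (betaPow N hq k)) = algebraMap _ _ (betaPow N hq k) :=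
      incl.commutes _
    rw [← map_pow]
    refine h1.trans ?_
    rw [IsScalarTower.algebraMap_apply _ (Zc q N ⧸ m.asIdeal)]
    exact (congrArg _ (Ideal.Quotient.eq_zero_iff_mem.2 hk)).trans (map_zero _)
  have hzero : incl (beta q N k) = 0 := by
    -- `e (β_k)` generates a nilpotent ideal of a matrix algebra
    have hB (Y : Matrix (Fin n) (Fin n) ℂ) :
        ∃ Y', e (incl (beta q N k)) * Y = Y' * e (incl (beta q N k)) := by
      obtain ⟨y, hy⟩ := exists_one_tmul_eq m.asIdeal (e.symm Y)
      obtain ⟨y', hy'⟩ := exists_beta_mul_eq (hq.ne_zero (by omega)) k y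
      refine ⟨e (incl y'), ?_⟩
      have hY : Y = e (incl y) := by rw [← e.apply_symm_apply Y, ← hy]; rfl
      rw [hY, ← map_mul, ← map_mul, hy', map_mul, map_mul]
    have hBpow : e (incl (beta q N k)) ^ ℓ = 0 := by rw [← map_pow, hpow, map_zero]
    rw [← map_eq_zero_iff e e.injective]
    generalize e (incl (beta q N k)) = B at hB hBpow
    by_contra hB0
    obtain ⟨i, j, hij⟩ : ∃ i j, B i j ≠ 0 := by
      by_contra! h
      exact hB0 (Matrix.ext h)
    -- By normality, `B * E_ji` is nilpotent along with `B`. Yet it squares to `B i j` times itself,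
    -- so `B i j ≠ 0` would make its powers nonzero.
    have hnil (s : ℕ) : ∃ Y, (B * Matrix.single j i 1) ^ s = Y * B ^ s := by
      induction s with
      | zero => exact ⟨1, by simp⟩
      | succ s ih =>
        obtain ⟨Y, hY⟩ := ih
        obtain ⟨W, hW⟩ := hB (Matrix.single j i 1)
        have hs (s : ℕ) : ∃ W', B ^ s * W = W' * B ^ s := by
          induction s with
          | zero => exact ⟨W, by simp⟩
          | succ s ih =>
            obtain ⟨W', hW'⟩ := ih
            obtain ⟨W'', hW''⟩ := hB W'
            exact ⟨W'', by rw [pow_succ', mul_assoc, hW', ← mul_assoc, hW'', mul_assoc]⟩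
        obtain ⟨W', hW'⟩ := hs s
        exact ⟨Y * W', by
          rw [pow_succ, hY, hW, mul_assoc, ← mul_assoc (B ^ s), hW', mul_assoc, mul_assoc, pow_succ]⟩
    have htr (s : ℕ) : (B * Matrix.single j i 1) ^ (s + 1) =
        B i j ^ s • (B * Matrix.single j i 1) := by
      induction s with
      | zero => simp
      | succ s ih =>
        rw [pow_succ, ih, smul_mul_assoc, mul_assoc, ← mul_assoc (Matrix.single j i 1),
          Matrix.single_mul_mul_single, one_mul, mul_one, pow_succ, mul_smul]
        congr 1
        rw [← mul_smul_comm, Matrix.smul_single, smul_eq_mul, mul_one]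
    obtain ⟨Y, hY⟩ := hnil (ℓ - 1 + 1)
    rw [htr, Nat.sub_add_cancel hℓ.le, hBpow, mul_zero,
      smul_eq_zero_iff_right (pow_ne_zero _ hij)] at hY
    have := congrFun (congrFun hY i) i
    rw [Matrix.mul_single_apply_same, mul_one] at this
    exact hij this
  have h1 := repr_mem_of_one_tmul_eq_zero (restrictedBasis N hℓ hodd hq) m.asIdeal hzero 0
  rw [restrictedBasis_repr_beta] at h1
  exact m.isMaximal.ne_top ((Ideal.eq_top_iff_one _).2 h1)

theorem azumayaLocus_eq (hℓ : 1 < ℓ) (hodd : Odd ℓ) (hq : IsPrimitiveRoot q ℓ) :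
    AzumayaLocus.azumayaLocus (Zc q N) (Dq q N) =
      {m | ∀ k : Fin (N + 1), betaPow N hq k.val ∉ m.asIdeal} := by
  ext m
  refine ⟨fun ⟨n, _, h⟩ k => betaPow_not_mem_of_fiberIsMatrix hℓ hodd hq h k, fun h => ?_⟩
  exact ⟨ℓ ^ N, pow_pos (by omega) _, fiberIsMatrix_center hℓ hodd hq m h⟩

/-- The complement of a prime ideal is a submonoid, so avoiding the generators suffices to avoid the
whole multiplicative set. -/
theorem mem_range_comap_iff (hq : IsPrimitiveRoot q ℓ) (m : MaximalSpectrum (Zc q N)) :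
    m.toPrimeSpectrum ∈ Set.range (PrimeSpectrum.comap (algebraMap (Zc q N) (ZLoc N hq))) ↔
      ∀ k : Fin (N + 1), betaPow N hq k.val ∉ m.asIdeal := by
  rw [PrimeSpectrum.localization_comap_range (ZLoc N hq) (betaSubmonoid N hq)]
  have hm := m.isMaximal.isPrime
  change Disjoint (betaSubmonoid N hq : Set (Zc q N)) m.asIdeal ↔ _
  have : Disjoint (betaSubmonoid N hq : Set (Zc q N)) m.asIdeal ↔
      betaSubmonoid N hq ≤ m.asIdeal.primeCompl := by
    rw [Set.disjoint_left]; rfl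
  rw [this, betaSubmonoid, Submonoid.closure_le, Set.range_subset_iff]
  rfl

/-! ## The localization -/

theorem isUnit_betaPow (hq : IsPrimitiveRoot q ℓ) (k : ℕ) :
    IsUnit (algebraMap (Zc q N) (ZLoc N hq) (betaPow N hq k)) := by
  obtain ⟨j, hj⟩ := betaPow_of_le (N := N) hq k
  rw [hj]
  exact IsLocalization.map_units (ZLoc N hq)
    (⟨_, Submonoid.subset_closure ⟨j, rfl⟩⟩ : betaSubmonoid N hq)

theorem finiteType_localization (hℓ : 1 < ℓ) (hodd : Odd ℓ) (hq : IsPrimitiveRoot q ℓ) :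
    Algebra.FiniteType ℂ (ZLoc N hq) := by
  have := finiteType_center (N := N) hℓ hodd hq
  have : Monoid.FG (betaSubmonoid N hq) := by
    rw [Monoid.fg_iff_submonoid_fg]
    exact ⟨(Set.finite_range fun k : Fin (N + 1) => betaPow N hq k.val).toFinset,
      by simp [betaSubmonoid]⟩
  have := IsLocalization.finiteType_of_monoid_fg (betaSubmonoid N hq) (ZLoc N hq)
  exact Algebra.FiniteType.trans (S := Zc q N) ‹_› ‹_›

/-- The restricted monomials as a basis of `D_q(ℂ^N)°` over `Z_N°`. -/
def localizedBasis (N : ℕ) (hℓ : 1 < ℓ) (hodd : Odd ℓ) (hq : IsPrimitiveRoot q ℓ) :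
    Module.Basis ((Fin N → Fin ℓ) × (Fin N → Fin ℓ)) (ZLoc N hq) (DLoc N hq) :=
  (restrictedBasis N hℓ hodd hq).baseChange (ZLoc N hq)

theorem fiberIsMatrix_localization (hℓ : 1 < ℓ) (hodd : Odd ℓ) (hq : IsPrimitiveRoot q ℓ)
    (m : MaximalSpectrum (ZLoc N hq)) :
    AzumayaLocus.FiberIsMatrix (ZLoc N hq) (DLoc N hq) m (ℓ ^ N) := by
  have := finiteType_localization (N := N) hℓ hodd hq
  let incl : Dq q N →ₐ[Zc q N] DLoc N hq := Algebra.TensorProduct.includeRight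
  refine fiberIsMatrix_of_not_mem (localizedBasis N hℓ hodd hq) (by simp) hℓ hodd hq
    (incl.restrictScalars ℂ) (fun k => algebraMap _ _ (betaPow N hq k)) (fun k => ?_) m
    -- After localization the `β_k ^ ℓ` are units, so no maximal ideal contains them.
    fun k hk => m.isMaximal.ne_top (Ideal.eq_top_of_isUnit_mem _ hk (isUnit_betaPow hq k))
  have h1 : incl (algebraMap _ _ (betaPow N hq k)) = algebraMap _ _ (betaPow N hq k) :=
    incl.commutes _
  rw [← map_pow, ← IsScalarTower.algebraMap_apply (Zc q N) (ZLoc N hq) (DLoc N hq)]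
  exact h1

theorem isAzumaya_localization (hℓ : 1 < ℓ) (hodd : Odd ℓ) (hq : IsPrimitiveRoot q ℓ) :
    IsAzumaya (ZLoc N hq) (DLoc N hq) := by
  have : NeZero ℓ := ⟨by omega⟩
  have h (m : MaximalSpectrum (ZLoc N hq)) :
      ∃ n, 0 < n ∧ AzumayaLocus.FiberIsMatrix (ZLoc N hq) (DLoc N hq) m n :=
    ⟨ℓ ^ N, pow_pos (by omega) _, fiberIsMatrix_localization hℓ hodd hq m⟩
  exact isAzumaya_of_fiberIsMatrix (R := ZLoc N hq) (A := DLoc N hq)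
    (localizedBasis N hℓ hodd hq) h

theorem isAzumayaOver_localization (hℓ : 1 < ℓ) (hodd : Odd ℓ) (hq : IsPrimitiveRoot q ℓ) :
    AzumayaLocus.IsAzumayaOver (ZLoc N hq) (DLoc N hq) :=
  have : Module.Free (ZLoc N hq) (DLoc N hq) := .of_basis (localizedBasis N hℓ hodd hq)
  isAzumayaOver_of_isAzumaya (isAzumaya_localization hℓ hodd hq) (Set.eq_univ_of_forall fun m =>
    ⟨ℓ ^ N, pow_pos (by omega) _, fiberIsMatrix_localization hℓ hodd hq m⟩)

end QDiff

end

theorem theorem2 (N ℓ : ℕ) (hℓ : 1 < ℓ) (hodd : Odd ℓ) (q : ℂ) (hq : IsPrimitiveRoot q ℓ) :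
    -- `D_q(ℂ^N)` is finitely generated and projective over its centre, and its Azumaya locus is
    -- the set of closed points of `Spec Z_N` lying in `Spec Z_N°`, the common nonvanishing locus
    -- of the `β_k ^ ℓ`
    Module.Finite (QDiff.Zc q N) (QDiff.Dq q N) ∧
    Module.Projective (QDiff.Zc q N) (QDiff.Dq q N) ∧
    AzumayaLocus.azumayaLocus (QDiff.Zc q N) (QDiff.Dq q N) =
      {m | m.toPrimeSpectrum ∈ Set.range
        (PrimeSpectrum.comap (algebraMap (QDiff.Zc q N) (QDiff.ZLoc N hq)))} ∧
    AzumayaLocus.azumayaLocus (QDiff.Zc q N) (QDiff.Dq q N) =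
      {m | ∀ k : Fin (N + 1), QDiff.betaPow N hq k.val ∉ m.asIdeal} ∧
    -- `D_q(ℂ^N)°` is Azumaya over `Z_N°`, fibrewise and in the sense of `A ⊗ Aᵒᵖ ≃ End A`
    AzumayaLocus.IsAzumayaOver (QDiff.ZLoc N hq) (QDiff.DLoc N hq) ∧
    IsAzumaya (QDiff.ZLoc N hq) (QDiff.DLoc N hq) ∧
    -- and of rank `ℓ ^ N × ℓ ^ N`
    ∀ m : MaximalSpectrum (QDiff.ZLoc N hq),
      AzumayaLocus.FiberIsMatrix (QDiff.ZLoc N hq) (QDiff.DLoc N hq) m (ℓ ^ N) := by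
  have : Module.Free (QDiff.Zc q N) (QDiff.Dq q N) :=
    .of_basis (QDiff.restrictedBasis N hℓ hodd hq)
  refine ⟨.of_basis (QDiff.restrictedBasis N hℓ hodd hq), inferInstance, ?_,
    QDiff.azumayaLocus_eq hℓ hodd hq, QDiff.isAzumayaOver_localization hℓ hodd hq,
    QDiff.isAzumaya_localization hℓ hodd hq, QDiff.fiberIsMatrix_localization hℓ hodd hq⟩
  rw [QDiff.azumayaLocus_eq hℓ hodd hq]
  exact Set.ext fun m => (QDiff.mem_range_comap_iff hq m).symm
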